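/- Let $R$ be a $\lambda$-ring, i.e. a commutative unital ring with operations $\lambda^i\colon R\to R$ ($i\ge 0$) satisfying $\lambda^0(r)=1$, $\lambda^1(r)=r$, $\lambda^i(1)=0$ for $i>1$, $\lambda^i(r+s)=\sum_{k=0}^i\lambda^k(r)\lambda^{i-k}(s)$, $\lambda^i(rs)=P_i(\lambda^1(r),\dots,\lambda^i(r);\lambda^1(s),\dots,\lambda^i(s))$ and $\lambda^i(\lambda^j(r))=P_{i,j}(\lambda^1(r),\dots,\lambda^{ij}(r))$, with $P_i$, $P_{i,j}$ the usual universal integer polynomials (what is often called a special $\lambda$-ring). Let $\psi^n$ ($n\ge 1$) be its Adams operations, given by the Newton formula $\psi^n(r)-\lambda^1(r)\psi^{n-1}(r)+\cdots+(-1)^{n-1}\lambda^{n-1}(r)\psi^1(r)+(-1)^n n\lambda^n(r)=0$. Let $\mathrm{End}(R)$ be the ring of $\mathbf Z$-linear endomorphisms of $R$, and $\overline{\mathrm{End}}(R)$ the subring of those $f$ with $f(r)^p\equiv f(r^p) \pmod{pR}$ for all primes $p$ and all $r\in R$. Let $T$ be the set of positive integers. Let $\mathcal F^*(R)$ be the cochain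 complex in which $\mathcal F^0=\overline{\mathrm{End}}(R)$, $\mathcal F^1$ is the group of functions $f\colon T\to\mathrm{End}(R)$ with $f(p)(R)\subseteq pR$ for all primes $p$, and $\mathcal F^n$ for $n\ge 2$ is the group of all functions $T^n\to\mathrm{End}(R)$, with differential $$(d^nf)(m_0,\dots,m_n)=\psi^{m_0}f(m_1,\dots,m_n)+\sum_{i=1}^n(-1)^if(m_0,\dots,m_{i-1}m_i,\dots,m_n)+(-1)^{n+1}f(m_0,\dots,m_{n-1})\psi^{m_n}.$$ Let $H^n_\lambda(R)$ be its $n$-th cohomology group. The composition product $(f\circ g)(m_1,\dots,m_{n+k})=f(m_1,\dots,m_n)\circ g(m_{n+1},\dots,m_{n+k})$ makes $H^*_\lambda(R)=\bigoplus_n H^n_\lambda(R)$ a graded, associative, unital algebra. Let $$H^{\le 1}_\lambda(R)=H^0_\lambda(R)\oplus H^1_\lambda(R)\cong H^*_\lambda(R)\Big/\bigoplus_{i\ge 2}H^i_\lambda(R)$$ be the quotient graded algebra. Let $\overline{\mathbf{Der}}_\lambda(R)$ be the group of families $\{f(p)\}_p$, indexed by the primes, of elements of $\mathrm{End}(R)$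 with $f(p)(R)\subseteq pR$ and $\psi^pf(q)+f(p)\psi^q=\psi^qf(p)+f(q)\psi^p$ for all primes $p,q$. Let $\overline{\mathbf{Inn}}_\lambda(R)$ be its subgroup of families $\{\psi^pg-g\psi^p\}_p$ with $g\in\overline{\mathrm{End}}(R)$, and let $\bar H^1_\lambda(R)=\overline{\mathbf{Der}}_\lambda(R)/\overline{\mathbf{Inn}}_\lambda(R)$. Let $\bar H^{\le 1}_\lambda(R)=H^0_\lambda(R)\oplus\bar H^1_\lambda(R)$, graded with the summands in degrees $0$ and $1$. Let $\pi\colon H^1_\lambda(R)\to\bar H^1_\lambda(R)$ be the homomorphism $[f]\mapsto[\{f(p)\}_p]$. **Corollary.** The map $(\mathrm{Id},\pi)\colon H^{\le 1}_\lambda(R)\to\bar H^{\le 1}_\lambda(R)$ is an isomorphism of groups, and it induces on $\bar H^{\le 1}_\lambda(R)$ a (unique) structure of unital, associative, graded algebra for which $(\mathrm{Id},\pi)$ is an isomorphism of graded algebras. In this structure, for every $g\in H^0_\lambda(R)$ (that is, $g\in\overline{\mathrm{End}}(R)$ commuting with all $\psi^n$) and every $\{f(p)\}_p\in\overline{\mathbf{Der}}_\lambda(R)$,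 $$g\circ[\{f(p)\}_p]=[\{g\,f(p)\}_p]\qquad\text{and}\qquad[\{f(p)\}_p]\circ g=[\{f(p)\,g\}_p],$$ where $g\,f(p)$ and $f(p)\,g$ denote composition of endomorphisms of $R$. -/

import Mathlib

open MvPolynomial in
theorem prod_one_add_mul_eq_sum_esymm {i : ℕ} {A : Type*} [CommRing A] (v : Fin i → A) (x : A) :
    ∏ n : Fin i, (1 + x * v n) =
      1 + ∑ k : Fin i, aeval v (esymm (Fin i) ℤ (k + 1)) * x ^ ((k : ℕ) + 1) := by
  have h1 : ∀ k : ℕ, aeval v (esymm (Fin i) ℤ k) * x ^ k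
      = ∑ t ∈ Finset.powersetCard k (Finset.univ : Finset (Fin i)), ∏ n ∈ t, x * v n := by
    intro k
    rw [esymm, map_sum, Finset.sum_mul]
    refine Finset.sum_congr rfl fun t ht => ?_
    rw [Finset.prod_mul_distrib, Finset.prod_const, (Finset.mem_powersetCard.1 ht).2, map_prod]
    simp [mul_comm]
  rw [Finset.prod_one_add, Finset.sum_powerset, Finset.card_univ, Fintype.card_fin,
    Finset.sum_range_succ', add_comm, Fin.sum_univ_eq_sum_range
      (fun k => aeval v (esymm (Fin i) ℤ (k + 1)) * x ^ (k + 1)) i]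
  congr 1
  · simp
  · exact Finset.sum_congr rfl fun k _ => (h1 (k + 1)).symm

open MvPolynomial in
theorem exists_mulPoly (i : ℕ) :
    ∃ P : MvPolynomial (Fin i ⊕ Fin i) ℤ,
      aeval (Sum.elim
        (fun k : Fin i => rename Sum.inl (esymm (Fin i) ℤ (k + 1)))
        (fun k : Fin i => rename Sum.inr (esymm (Fin i) ℤ (k + 1)))) P =
      Polynomial.coeff (∏ m : Fin i, ∏ n : Fin i,
        (1 + Polynomial.C (X (Sum.inl m) * X (Sum.inr n) : MvPolynomial (Fin i ⊕ Fin i) ℤ) *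
          Polynomial.X)) i := by
  let Q : Polynomial (MvPolynomial (Fin i) (MvPolynomial (Fin i) ℤ)) :=
    ∏ m : Fin i, (1 + ∑ k : Fin i,
      Polynomial.C (C (X k)) * (Polynomial.C (X m) * Polynomial.X) ^ ((k : ℕ) + 1))
  have hQ : (Q.coeff i).IsSymmetric := by
    intro e
    have : rename e (Q.coeff i) = (Q.map (rename e).toRingHom).coeff i := by
      rw [Polynomial.coeff_map]; rfl
    rw [this]
    congr 1
    simp only [Q, Polynomial.map_prod, Polynomial.map_add, Polynomial.map_one, Polynomial.map_sum,
      Polynomial.map_mul, Polynomial.map_pow, Polynomial.map_C, Polynomial.map_X,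
      AlgHom.toRingHom_eq_coe, RingHom.coe_coe, rename_C, rename_X]
    exact Equiv.prod_comp e (fun m => (1 + ∑ k : Fin i,
      Polynomial.C (C (X k)) * (Polynomial.C (X m) * Polynomial.X) ^ ((k : ℕ) + 1)))
  obtain ⟨P', hP'⟩ := esymmAlgHom_surjective (σ := Fin i) (MvPolynomial (Fin i) ℤ) (n := i)
    (by simp) ⟨Q.coeff i, hQ⟩
  have hP'' : aeval (fun k : Fin i => esymm (Fin i) (MvPolynomial (Fin i) ℤ) (k + 1)) P'
      = Q.coeff i := by
    rw [← esymmAlgHom_apply, hP']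
  let ι : MvPolynomial (Fin i) ℤ →+* MvPolynomial (Fin i ⊕ Fin i) ℤ :=
    (aeval (fun k : Fin i => rename Sum.inr (esymm (Fin i) ℤ (k + 1)))).toRingHom
  let φ : MvPolynomial (Fin i) (MvPolynomial (Fin i) ℤ) →+* MvPolynomial (Fin i ⊕ Fin i) ℤ :=
    eval₂Hom ι (fun m => X (Sum.inl m))
  refine ⟨(sumAlgEquiv ℤ (Fin i) (Fin i)).symm P', ?_⟩
  have hφQ : φ (Q.coeff i) = (Q.map φ).coeff i := by rw [Polynomial.coeff_map]
  have h2 : Q.map φ = ∏ m : Fin i, ∏ n : Fin i,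
        (1 + Polynomial.C (X (Sum.inl m) * X (Sum.inr n) : MvPolynomial (Fin i ⊕ Fin i) ℤ) *
          Polynomial.X) := by
    simp only [Q, Polynomial.map_prod]
    refine Finset.prod_congr rfl fun m _ => ?_
    have := prod_one_add_mul_eq_sum_esymm
      (fun n : Fin i => Polynomial.C (X (Sum.inr n) : MvPolynomial (Fin i ⊕ Fin i) ℤ))
      (Polynomial.C (X (Sum.inl m)) * Polynomial.X)
    have h3 : ∀ n : Fin i,
      (1 + Polynomial.C (X (Sum.inl m) * X (Sum.inr n) : MvPolynomial (Fin i ⊕ Fin i) ℤ) *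
          Polynomial.X) = 1 + Polynomial.C (X (Sum.inl m)) * Polynomial.X *
            Polynomial.C (X (Sum.inr n)) := by
      intro n; rw [map_mul]; ring
    rw [Finset.prod_congr rfl fun n _ => h3 n, this]
    simp only [Polynomial.map_add, Polynomial.map_one, Polynomial.map_sum,
      Polynomial.map_mul, Polynomial.map_pow, Polynomial.map_C, Polynomial.map_X]
    rw [add_right_inj]
    refine Finset.sum_congr rfl fun k _ => congrArg₂ (· * ·) ?_ ?_
    · simp only [φ, ι, coe_eval₂Hom, eval₂_C, AlgHom.toRingHom_eq_coe, RingHom.coe_coe, aeval_X]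
      simp [esymm, map_sum, map_prod]
    · simp [φ]
  have h4 : ∀ P : MvPolynomial (Fin i) (MvPolynomial (Fin i) ℤ),
      aeval (Sum.elim
        (fun k : Fin i => rename Sum.inl (esymm (Fin i) ℤ (k + 1)))
        (fun k : Fin i => rename Sum.inr (esymm (Fin i) ℤ (k + 1))))
        ((sumAlgEquiv ℤ (Fin i) (Fin i)).symm P)
      = φ (aeval (fun k : Fin i => esymm (Fin i) (MvPolynomial (Fin i) ℤ) (k + 1)) P) := by
    intro P
    obtain ⟨P, rfl⟩ := (sumAlgEquiv ℤ (Fin i) (Fin i)).surjective P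
    rw [AlgEquiv.symm_apply_apply]
    induction P using MvPolynomial.induction_on with
    | C a => simp [φ]
    | add p q hp hq => rw [map_add, map_add, map_add, map_add, hp, hq]
    | mul_X p k hp =>
      rw [map_mul, map_mul, map_mul, map_mul, hp]
      congr 1
      cases k with
      | inl k => simp [φ, esymm, map_sum, map_prod]
      | inr k => simp [φ, ι]
  rw [h4, hP'', hφQ, h2]

open MvPolynomial in
theorem exists_compPoly (i j : ℕ) :
    ∃ P : MvPolynomial (Fin (i * j)) ℤ,
      aeval (fun k : Fin (i * j) => esymm (Fin (i * j)) ℤ (k + 1)) P =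
      Polynomial.coeff (∏ S ∈ Finset.powersetCard j (Finset.univ : Finset (Fin (i * j))),
        (1 + Polynomial.C (∏ l ∈ S, X l : MvPolynomial (Fin (i * j)) ℤ) * Polynomial.X)) i := by
  set Q : Polynomial (MvPolynomial (Fin (i * j)) ℤ) :=
    ∏ S ∈ Finset.powersetCard j (Finset.univ : Finset (Fin (i * j))),
        (1 + Polynomial.C (∏ l ∈ S, X l : MvPolynomial (Fin (i * j)) ℤ) * Polynomial.X) with hQd
  have hQ : (Q.coeff i).IsSymmetric := by
    intro e
    have : rename e (Q.coeff i) = (Q.map (rename e).toRingHom).coeff i := by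
      rw [Polynomial.coeff_map]; rfl
    rw [this]
    congr 1
    simp only [hQd, Polynomial.map_prod, Polynomial.map_add, Polynomial.map_one,
      Polynomial.map_mul, Polynomial.map_C, Polynomial.map_X,
      AlgHom.toRingHom_eq_coe, RingHom.coe_coe, map_prod, rename_X]
    refine Finset.prod_nbij' (fun S => S.map e.toEmbedding) (fun S => S.map e.symm.toEmbedding)
      ?_ ?_ ?_ ?_ ?_
    · intro S hS; simpa [Finset.mem_powersetCard] using hS
    · intro S hS; simpa [Finset.mem_powersetCard] using hS
    · intro S _; ext; simp
    · intro S _; ext; simp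
    · intro S _; simp
  obtain ⟨P', hP'⟩ := esymmAlgHom_surjective (σ := Fin (i * j)) ℤ (n := i * j)
    (by simp) ⟨Q.coeff i, hQ⟩
  exact ⟨P', by rw [← esymmAlgHom_apply, hP']⟩

/-- The universal polynomial `P_i` in the `2i` variables `X (inl k)`, `X (inr k)` (`k < i`), which
stand for the elementary symmetric functions `s_{k+1}` of the variables `ξ` and `σ_{k+1}` of the variables `η`. -/
noncomputable def mulPoly (i : ℕ) : MvPolynomial (Fin i ⊕ Fin i) ℤ :=
  (exists_mulPoly i).choose

/-- The universal polynomial `P_{i,j}` in the `ij` variables `X k` (`k < ij`), which stand for the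
elementary symmetric functions `s_{k+1}` of the variables `ξ`. -/
noncomputable def compPoly (i j : ℕ) : MvPolynomial (Fin (i * j)) ℤ :=
  (exists_compPoly i j).choose

/-- A (special) `λ`-ring structure on a commutative ring. -/
class LambdaRing (R : Type*) [CommRing R] where
  /-- The `λ`-operations. -/
  lam : ℕ → R → R
  lam_zero : ∀ r, lam 0 r = 1
  lam_one : ∀ r, lam 1 r = r
  lam_apply_one : ∀ i, 1 < i → lam i 1 = 0
  lam_add : ∀ i r s, lam i (r + s) = ∑ k ∈ Finset.range (i + 1), lam k r * lam (i - k) s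
  lam_mul : ∀ i r s, lam i (r * s) =
    MvPolynomial.aeval (Sum.elim (fun k : Fin i => lam (k + 1) r)
      (fun k : Fin i => lam (k + 1) s)) (mulPoly i)
  lam_lam : ∀ i j r, lam i (lam j r) =
    MvPolynomial.aeval (fun k : Fin (i * j) => lam (k + 1) r) (compPoly i j)

namespace LambdaRing

section Adams

variable {R : Type*} [CommRing R] [LambdaRing R]

/-- The Adams operation `ψ^n` as a function, defined inductively by the Newton formula
`ψ^n(r) = ∑_{k=1}^{n-1} (-1)^{k-1} λ^k(r) ψ^{n-k}(r) + (-1)^{n-1} n λ^n(r)`. (The value at `n = 0`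
is zero and is not used.) -/
def adams (n : ℕ) (r : R) : R :=
  (∑ k : Fin (n - 1), (-1) ^ (k : ℕ) * lam ((k : ℕ) + 1) r * adams (n - ((k : ℕ) + 1)) r) -
    (-1) ^ n * (n : R) * lam n r
termination_by n
decreasing_by have := k.2; omega

theorem adams_zero (r : R) : adams 0 r = 0 := by
  rw [adams]; simp

/-- The Newton formula. -/
theorem newton (n : ℕ) (r : R) :
    ∑ k ∈ Finset.range n, (-1) ^ k * lam k r * adams (n - k) r + (-1) ^ n * (n : R) * lam n r
      = 0 := by
  rcases n with _ | n
  · simp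
  · have hA : adams (n + 1) r = (∑ k : Fin n, (-1) ^ (k : ℕ) * lam ((k : ℕ) + 1) r *
        adams (n + 1 - ((k : ℕ) + 1)) r) - (-1) ^ (n + 1) * ((n + 1 : ℕ) : R) * lam (n + 1) r := by
      rw [adams]; rfl
    rw [Finset.sum_range_succ', lam_zero, Nat.sub_zero, hA,
      Fin.sum_univ_eq_sum_range (fun k => (-1) ^ k * lam (k + 1) r * adams (n + 1 - (k + 1)) r)]
    have : ∀ k ∈ Finset.range n, (-1) ^ (k + 1) * lam (k + 1) r * adams (n + 1 - (k + 1)) r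
        = - ((-1) ^ k * lam (k + 1) r * adams (n + 1 - (k + 1)) r) := fun k _ => by ring
    rw [Finset.sum_congr rfl this, Finset.sum_neg_distrib]
    simp only [pow_zero, one_mul]
    ring

open PowerSeries in
theorem adams_add (n : ℕ) (r s : R) : adams n (r + s) = adams n r + adams n s := by
  let L : R → PowerSeries R := fun r => PowerSeries.mk fun n => (-1) ^ n * lam n r
  let Ψ : R → PowerSeries R := fun r => PowerSeries.mk fun n => adams n r
  have hL : ∀ r s, L (r + s) = L r * L s := by
    intro r s
    ext n
    simp only [L, coeff_mk, coeff_mul, lam_add]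
    rw [Finset.Nat.sum_antidiagonal_eq_sum_range_succ_mk, Finset.mul_sum]
    refine Finset.sum_congr rfl fun k hk => ?_
    have hk' : k ≤ n := Nat.lt_succ_iff.1 (Finset.mem_range.1 hk)
    have : (-1 : R) ^ n = (-1) ^ k * (-1) ^ (n - k) := by
      rw [← pow_add, Nat.add_sub_cancel' hk']
    rw [this]; ring
  have hN : ∀ r, L r * Ψ r = - (X * derivative R (L r)) := by
    intro r
    ext n
    have h := newton n r
    rw [← eq_neg_iff_add_eq_zero] at h
    simp only [L, Ψ, coeff_mk, coeff_mul]
    rw [Finset.Nat.sum_antidiagonal_eq_sum_range_succ_mk, Finset.sum_range_succ]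
    simp only [Nat.sub_self, adams_zero, mul_zero, add_zero, h, map_neg]
    congr 1
    rcases n with _ | n
    · simp
    · rw [coeff_succ_X_mul, coeff_derivative, coeff_mk]
      push_cast; ring
  have hunit : ∀ r, IsUnit (L r) := by
    intro r
    rw [isUnit_iff_constantCoeff]
    simp [L, ← coeff_zero_eq_constantCoeff_apply, lam_zero]
  have key : L (r + s) * Ψ (r + s) = L (r + s) * (Ψ r + Ψ s) := by
    rw [hN, hL, Derivation.leibniz, smul_eq_mul, smul_eq_mul]
    linear_combination (- L s) * hN r + (- L r) * hN s
  have := (hunit (r + s)).mul_left_cancel key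
  have := congrArg (coeff n) this
  simpa [Ψ] using this

/-- The Adams operation `ψ^n`, `n ≥ 1`, as a `ℤ`-linear endomorphism. -/
def psi (n : ℕ+) : Module.End ℤ R :=
  (AddMonoidHom.mk' (adams (n : ℕ)) (adams_add n)).toIntLinearMap

end Adams

variable (R : Type*) [CommRing R]

/-- The subring `\overline{End}(R)` of `End(R)`: the `ℤ`-linear endomorphisms `f` of `R` such that
`f(r)^p ≡ f(r^p) mod pR` for every prime `p` and every `r`. -/
def endBar : Subring (Module.End ℤ R) where
  carrier := {f | ∀ p : ℕ, p.Prime → ∀ r : R, (p : R) ∣ f r ^ p - f (r ^ p)}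
  mul_mem' := by
    intro f g hf hg p hp r
    obtain ⟨c, hc⟩ := hg p hp r
    obtain ⟨d, hd⟩ := hf p hp (g r)
    refine ⟨d + f c, ?_⟩
    have h1 : g r ^ p = g (r ^ p) + p • c := by
      rw [nsmul_eq_mul, ← hc]; ring
    rw [h1, map_add, map_nsmul, nsmul_eq_mul] at hd
    simp only [Module.End.mul_apply]
    linear_combination hd
  one_mem' := by intro p _ r; simp
  add_mem' := by
    intro f g hf hg p hp r
    obtain ⟨c, hc⟩ := hf p hp r
    obtain ⟨d, hd⟩ := hg p hp r
    obtain ⟨e, he⟩ := exists_add_pow_prime_eq hp (f r) (g r)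
    refine ⟨c + d + f r * g r * e, ?_⟩
    simp only [LinearMap.add_apply]
    linear_combination he + hc + hd
  zero_mem' := by
    intro p hp r
    simp [hp.ne_zero]
  neg_mem' := by
    intro f hf p hp r
    obtain ⟨c, hc⟩ := hf p hp r
    simp only [LinearMap.neg_apply]
    rcases hp.eq_two_or_odd' with rfl | ho
    · refine ⟨f r ^ 2 - c, ?_⟩
      push_cast at hc ⊢
      linear_combination - hc
    · refine ⟨- c, ?_⟩
      rw [ho.neg_pow]
      linear_combination - hc

/-- All functions `T^n → End(R)`, where `T` is the set of positive integers. -/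
abbrev Coch (n : ℕ) : Type _ := (Fin n → ℕ+) → Module.End ℤ R

/-- The group `F^n` of `n`-cochains. For `n = 0` it is (the additive group of) `\overline{End}(R)`,
an endomorphism being regarded as a function on the one-point set `T^0`; for `n = 1` it consists of
the `f : T → End(R)` with `f(p)(R) ⊆ pR` for all primes `p`; for `n ≥ 2` there is no condition. -/
def F : (n : ℕ) → AddSubgroup (Coch R n)
  | 0 => (endBar R).toAddSubgroup.comap (Pi.evalAddMonoidHom _ (default : Fin 0 → ℕ+))
  | 1 =>
    { carrier := {f | ∀ p : Nat.Primes, ∀ r : R, ((p : ℕ) : R) ∣ f (fun _ => (p : ℕ+)) r}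
      add_mem' := fun hf hg p r => dvd_add (hf p r) (hg p r)
      zero_mem' := fun _ _ => dvd_zero _
      neg_mem' := fun hf p r => (hf p r).neg_right }
  | _ + 2 => ⊤

variable {R}

/-- The composition product of cochains,
`(f ∘ g)(m_1, …, m_{n+k}) = f(m_1, …, m_n) ∘ g(m_{n+1}, …, m_{n+k})`. -/
def comp {n k : ℕ} (f : Coch R n) (g : Coch R k) : Coch R (n + k) :=
  fun m => f (fun i => m (Fin.castAdd k i)) * g (fun j => m (Fin.natAdd n j))

theorem F_eq_top {n : ℕ} (h : 2 ≤ n) : F R n = ⊤ := by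
  match n, h with
  | _ + 2, _ => rfl

theorem comp_mem_F {n k : ℕ} {f : Coch R n} {g : Coch R k} (hf : f ∈ F R n) (hg : g ∈ F R k) :
    comp f g ∈ F R (n + k) := by
  by_cases h : 2 ≤ n + k
  · rw [F_eq_top h]; trivial
  · match n, k, h with
    | 0, 0, _ =>
      have := (endBar R).mul_mem hf hg
      have e : ∀ m : Fin 0 → ℕ+, m = default := fun m => Subsingleton.elim _ _
      change f _ * g _ ∈ endBar R
      rw [e fun i => (default : Fin 0 → ℕ+) (Fin.castAdd 0 i),
        e fun j => (default : Fin 0 → ℕ+) (Fin.natAdd 0 j)]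
      exact this
    | 0, 1, _ =>
      intro p r
      obtain ⟨c, hc⟩ := hg p r
      change _ ∣ f _ (g (fun _ => (p : ℕ+)) r)
      rw [hc, ← nsmul_eq_mul, map_nsmul, nsmul_eq_mul]
      exact dvd_mul_right _ _
    | 1, 0, _ =>
      intro p r
      exact hf p _
    | 1, 1, h => omega
    | n + 2, k, h => omega
    | n, k + 2, h => omega

variable [LambdaRing R]

/-- The differential
`(d^n f)(m_0, …, m_n) = ψ^{m_0} f(m_1, …, m_n) + ∑_{i=1}^n (-1)^i f(m_0, …, m_{i-1} m_i, …, m_n)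
  + (-1)^{n+1} f(m_0, …, m_{n-1}) ψ^{m_n}`.
`Fin.contractNth i (· * ·) m` is the sequence `m` with its consecutive entries numbered `i` and
`i + 1` (counting from `0`) replaced by their product. -/
def d (n : ℕ) : Coch R n →+ Coch R (n + 1) where
  toFun f m :=
    psi (m 0) * f (fun i => m i.succ) +
      ∑ i : Fin n, (-1 : ℤ) ^ ((i : ℕ) + 1) • f (Fin.contractNth i.castSucc (· * ·) m) +
      (-1 : ℤ) ^ (n + 1) • (f (fun i => m i.castSucc) * psi (m (Fin.last n)))
  map_zero' := by ext; simp
  map_add' f g := by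
    ext1 m
    simp only [Pi.add_apply, mul_add, add_mul, smul_add, Finset.sum_add_distrib]
    abel

theorem d_apply {n : ℕ} (f : Coch R n) (m : Fin (n + 1) → ℕ+) :
    d n f m = psi (m 0) * f (fun i => m i.succ) +
      ∑ i : Fin n, (-1 : ℤ) ^ ((i : ℕ) + 1) • f (Fin.contractNth i.castSucc (· * ·) m) +
      (-1 : ℤ) ^ (n + 1) • (f (fun i => m i.castSucc) * psi (m (Fin.last n))) := rfl

/-- The Leibniz identity `d(f ∘ g) = df ∘ g + (-1)^n f ∘ dg`, evaluated. -/
theorem leibniz {n k : ℕ} (f : Coch R n) (g : Coch R k) (m : Fin (n + k + 1) → ℕ+) :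
    d (n + k) (comp f g) m =
      d n f (fun i => m ⟨i, by omega⟩) * g (fun j => m ⟨n + 1 + j, by omega⟩) +
      (-1 : ℤ) ^ n • (f (fun i => m ⟨i, by omega⟩) * d k g (fun j => m ⟨n + j, by omega⟩)) := by
  have e1 : ∀ i : Fin n, comp f g (Fin.contractNth (Fin.castAdd k i).castSucc (· * ·) m) =
      f (Fin.contractNth i.castSucc (· * ·) (fun i => m ⟨i, by omega⟩)) *
        g (fun j => m ⟨n + 1 + j, by omega⟩) := by
    intro i
    refine congrArg₂ (· * ·) (congrArg f rfl) (congrArg g ?_)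
    funext j
    have := i.2
    rw [Fin.contractNth_apply_of_gt _ _ _ _ (by simp; omega)]
    congr 1; ext; simp; omega
  have e2 : ∀ i : Fin k, comp f g (Fin.contractNth (Fin.natAdd n i).castSucc (· * ·) m) =
      f (fun i => m ⟨i, by omega⟩) *
        g (Fin.contractNth i.castSucc (· * ·) (fun j => m ⟨n + j, by omega⟩)) := by
    intro i
    refine congrArg₂ (· * ·) (congrArg f ?_) (congrArg g ?_)
    · funext j
      have := j.2
      rw [Fin.contractNth_apply_of_lt _ _ _ _ (by simp; omega)]
      rfl
    · funext j
      simp only [Fin.contractNth, Fin.val_natAdd, Fin.val_castSucc, add_lt_add_iff_left,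
        add_right_inj]
      rfl
  have e3 : comp f g (fun i => m i.succ) =
      f (fun i => m ⟨i + 1, by omega⟩) * g (fun j => m ⟨n + 1 + j, by omega⟩) := by
    refine congrArg₂ (· * ·) (congrArg f rfl) (congrArg g ?_)
    funext j
    exact congrArg m (Fin.ext (by simp; omega))
  have e4 : comp f g (fun i => m i.castSucc) =
      f (fun i => m ⟨i, by omega⟩) * g (fun j => m ⟨n + j, by omega⟩) := rfl
  have e5 : (fun j : Fin k => m ⟨n + (j.succ : Fin (k + 1)), by have := j.2; simp⟩) =
      fun j : Fin k => m ⟨n + 1 + j, by omega⟩ := by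
    funext j
    exact congrArg m (Fin.ext (by simp; omega))
  rw [d_apply, d_apply, d_apply, Fin.sum_univ_add, e3, e4, e5,
    Finset.sum_congr rfl fun i _ => congrArg _ (e1 i),
    Finset.sum_congr rfl fun i _ => congrArg _ (e2 i)]
  have e6 : ∑ i : Fin k, (-1 : ℤ) ^ ((Fin.natAdd n i : ℕ) + 1) •
      (f (fun i => m ⟨i, by omega⟩) *
        g (Fin.contractNth i.castSucc (· * ·) (fun j => m ⟨n + j, by omega⟩))) =
      (-1 : ℤ) ^ n • (f (fun i => m ⟨i, by omega⟩) * ∑ i : Fin k, (-1 : ℤ) ^ ((i : ℕ) + 1) •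
        g (Fin.contractNth i.castSucc (· * ·) (fun j => m ⟨n + j, by omega⟩))) := by
    rw [Finset.mul_sum, Finset.smul_sum]
    refine Finset.sum_congr rfl fun i _ => ?_
    rw [mul_smul_comm, smul_smul, Fin.val_natAdd]
    congr 1; ring
  have e7 : (-1 : ℤ) ^ (n + k + 1) = (-1) ^ n * (-1) ^ (k + 1) := by ring
  have e8 : (-1 : ℤ) ^ (n + 1) = - (-1) ^ n := by ring
  rw [e6, e7, e8]
  simp only [mul_add, add_mul, smul_add, Finset.sum_mul, smul_mul_assoc, neg_smul, neg_mul,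
    mul_smul_comm, mul_smul, mul_assoc]
  have e9 : m (0 : Fin (n + k + 1)) = m ⟨((0 : Fin (n + 1)) : ℕ), by omega⟩ := rfl
  have e10 : m (Fin.last (n + k)) = m ⟨n + (Fin.last k : Fin (k + 1)), by simp⟩ := rfl
  simp only [e9, e10, Fin.val_last, Fin.val_zero, Fin.val_succ, Fin.val_castSucc,
    Fin.val_castAdd, add_zero]
  abel

/-! ### Cohomology -/

variable (R)

/-- The group of `n`-cocycles: the kernel of `d^n` on `F^n`. -/
def Z (n : ℕ) : AddSubgroup (Coch R n) := F R n ⊓ (d n).ker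

/-- The group of `n`-coboundaries: the image of `F^{n-1}` under `d^{n-1}` (zero for `n = 0`). -/
def B : (n : ℕ) → AddSubgroup (Coch R n)
  | 0 => ⊥
  | n + 1 => (F R n).map (d n)

/-- The `λ`-ring cohomology group `H^n(R)`, the quotient of cocycles by coboundaries. (`addSubgroupOf`
regards the group of coboundaries, which are cocycles because `d` maps `F^n` to `F^{n+1}` and
`d ∘ d = 0`, as a subgroup of the group of cocycles.) -/
def H (n : ℕ) : Type _ := Z R n ⧸ (B R n).addSubgroupOf (Z R n)

instance (n : ℕ) : AddCommGroup (H R n) :=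
  inferInstanceAs (AddCommGroup (Z R n ⧸ (B R n).addSubgroupOf (Z R n)))

variable {R}

/-- The cohomology class `[f]` of a cocycle `f`. -/
def H.mk {n : ℕ} : Z R n →+ H R n := QuotientAddGroup.mk' _

theorem H.mk_surjective {n : ℕ} : Function.Surjective (H.mk : Z R n →+ H R n) :=
  QuotientAddGroup.mk'_surjective _

theorem H.mk_eq_zero {n : ℕ} {f : Z R n} (hf : f.1 ∈ B R n) : H.mk f = 0 :=
  (QuotientAddGroup.eq_zero_iff f).2 hf

/-- The homomorphism on cohomology induced by a homomorphism on cocycles that kills the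
coboundaries. -/
def H.lift {n : ℕ} {A : Type*} [AddCommGroup A] (φ : Z R n →+ A)
    (hφ : ∀ f : Z R n, f.1 ∈ B R n → φ f = 0) : H R n →+ A :=
  QuotientAddGroup.lift ((B R n).addSubgroupOf (Z R n)) φ hφ

theorem H.lift_mk {n : ℕ} {A : Type*} [AddCommGroup A] (φ : Z R n →+ A)
    (hφ : ∀ f : Z R n, f.1 ∈ B R n → φ f = 0) (f : Z R n) : H.lift φ hφ (H.mk f) = φ f := rfl

theorem comp_mem_Z {n k : ℕ} {f : Coch R n} {g : Coch R k} (hf : f ∈ Z R n) (hg : g ∈ Z R k) :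
    comp f g ∈ Z R (n + k) := by
  refine ⟨comp_mem_F hf.1 hg.1, ?_⟩
  have h1 : d n f = 0 := hf.2
  have h2 : d k g = 0 := hg.2
  change d (n + k) (comp f g) = 0
  funext m
  rw [leibniz, h1, h2]
  simp

theorem mem_B {N k : ℕ} (h : N = k + 1) {f : Coch R N} {g : Coch R k} (hg : g ∈ F R k)
    (hfg : ∀ m : Fin (k + 1) → ℕ+, f (fun i => m (Fin.cast h i)) = d k g m) : f ∈ B R N := by
  subst h
  exact ⟨g, hg, funext fun m => (hfg m).symm⟩

theorem comp_mem_B_right {n k : ℕ} {f : Coch R n} {g : Coch R k} (hf : f ∈ Z R n) (hg : g ∈ B R k) :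
    comp f g ∈ B R (n + k) := by
  rcases k with _ | k
  · rw [show g = 0 from hg]
    have : comp f (0 : Coch R 0) = 0 := by ext1 m; simp [comp]
    rw [this]
    exact zero_mem _
  · obtain ⟨h, hh, rfl⟩ := hg
    have h1 : d n f = 0 := hf.2
    refine mem_B (k := n + k) rfl ((F R _).zsmul_mem (comp_mem_F hf.1 hh) ((-1) ^ n)) fun m => ?_
    rw [map_zsmul, Pi.smul_apply, leibniz, h1, Pi.zero_apply, zero_mul, zero_add, smul_smul,
      ← mul_pow]
    simp only [mul_neg, mul_one, neg_neg, one_pow, one_smul]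
    rfl

theorem comp_mem_B_left {n k : ℕ} {f : Coch R n} {g : Coch R k} (hf : f ∈ B R n) (hg : g ∈ Z R k) :
    comp f g ∈ B R (n + k) := by
  rcases n with _ | n
  · rw [show f = 0 from hf]
    have : comp (0 : Coch R 0) g = 0 := by ext1 m; simp [comp]
    rw [this]
    exact zero_mem _
  · obtain ⟨h, hh, rfl⟩ := hf
    have h1 : d k g = 0 := hg.2
    refine mem_B (k := n + k) (by omega) (comp_mem_F hh hg.1) fun m => ?_
    rw [leibniz, h1, Pi.zero_apply, mul_zero, smul_zero, add_zero]
    rfl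

/-- The composition product of cocycles, as a biadditive map. -/
def compZ (n k : ℕ) : Z R n →+ Z R k →+ Z R (n + k) where
  toFun f :=
    { toFun := fun g => ⟨comp f.1 g.1, comp_mem_Z f.2 g.2⟩
      map_zero' := Subtype.ext (funext fun _ => mul_zero _)
      map_add' := fun _ _ => Subtype.ext (funext fun _ => mul_add _ _ _) }
  map_zero' := AddMonoidHom.ext fun _ => Subtype.ext (funext fun _ => zero_mul _)
  map_add' _ _ := AddMonoidHom.ext fun _ => Subtype.ext (funext fun _ => add_mul _ _ _)

/-- The composition product on cohomology, `[f] ∘ [g] = [f ∘ g]`. -/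
def compH (n k : ℕ) : H R n →+ H R k →+ H R (n + k) :=
  H.lift
    { toFun := fun f => H.lift (H.mk.comp (compZ n k f))
        (fun _ hg => H.mk_eq_zero (comp_mem_B_right f.2 hg))
      map_zero' := by
        ext g
        obtain ⟨g, rfl⟩ := H.mk_surjective g
        simp [H.lift_mk]
      map_add' := fun f f' => by
        ext g
        obtain ⟨g, rfl⟩ := H.mk_surjective g
        simp [H.lift_mk] }
    (fun f hf => by
      ext g
      obtain ⟨g, rfl⟩ := H.mk_surjective g
      exact H.mk_eq_zero (comp_mem_B_left hf g.2))

theorem compH_mk {n k : ℕ} (f : Z R n) (g : Z R k) :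
    compH n k (H.mk f) (H.mk g) = H.mk (compZ n k f g) := rfl

theorem one_mem_Z : (fun _ => 1 : Coch R 0) ∈ Z R 0 := by
  refine ⟨(endBar R).one_mem, ?_⟩
  change d 0 _ = 0
  funext m
  rw [d_apply]
  simp

theorem gradedMk_eq {n m : ℕ} (h : n = m) (a : Z R n) (b : Z R m)
    (hab : ∀ x : Fin m → ℕ+, a.1 (fun i => x (Fin.cast h i)) = b.1 x) :
    GradedMonoid.mk (A := H R) n (H.mk a) =
      GradedMonoid.mk (A := H R) m (H.mk b) := by
  subst h
  have : a = b := Subtype.ext (funext hab)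
  rw [this]

instance : GradedMonoid.GMul (H R) where
  mul {n k} a b := compH n k a b

instance : GradedMonoid.GOne (H R) where
  one := H.mk ⟨fun _ => 1, one_mem_Z⟩

instance : GradedMonoid.GMonoid (H R) where
  one_mul := by
    rintro ⟨n, a⟩
    obtain ⟨a, rfl⟩ := H.mk_surjective a
    refine gradedMk_eq (zero_add n) _ a fun x => ?_
    refine (one_mul _).trans (congrArg a.1 (funext fun i => congrArg x (Fin.ext ?_)))
    simp
  mul_one := by
    rintro ⟨n, a⟩
    obtain ⟨a, rfl⟩ := H.mk_surjective a
    exact gradedMk_eq (add_zero n) _ a fun x => mul_one _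
  mul_assoc := by
    rintro ⟨n, a⟩ ⟨k, b⟩ ⟨l, c⟩
    obtain ⟨a, rfl⟩ := H.mk_surjective a
    obtain ⟨b, rfl⟩ := H.mk_surjective b
    obtain ⟨c, rfl⟩ := H.mk_surjective c
    refine gradedMk_eq (add_assoc n k l) (compZ _ _ (compZ _ _ a b) c)
      (compZ _ _ a (compZ _ _ b c)) fun x => ?_
    refine (mul_assoc _ _ _).trans ?_
    refine congrArg₂ (· * ·) rfl (congrArg₂ (· * ·) rfl ?_)
    refine congrArg c.1 (funext fun i => congrArg x (Fin.ext ?_))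
    simp [add_assoc]

/-- `H^*(R)` is a graded, associative, unital ring under the composition product, with unit the
class of `Id_R`. -/
instance : DirectSum.GRing (H R) where
  mul_zero a := map_zero (compH _ _ a)
  zero_mul b := by
    change compH _ _ 0 b = 0
    rw [map_zero]; rfl
  mul_add a b c := map_add (compH _ _ a) _ _
  add_mul a b c := by
    change compH _ _ (a + b) c = compH _ _ a c + compH _ _ b c
    rw [map_add]; rfl
  natCast n := n • (GradedMonoid.GOne.one : H R 0)
  natCast_zero := zero_nsmul _
  natCast_succ n := succ_nsmul _ n
  intCast n := n • (GradedMonoid.GOne.one : H R 0)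
  intCast_ofNat n := natCast_zsmul _ n
  intCast_negSucc_ofNat n := negSucc_zsmul _ n

variable (R)

/-- The total cohomology `H^*(R) = ⨁_n H^n(R)`, a ring under the composition product. -/
abbrev HStar : Type _ := DirectSum ℕ (H R)

variable {R}

theorem of_mul_apply_of_two_le (j : ℕ) (hj : 2 ≤ j) (x : H R j) (c : HStar R) (k : ℕ) (hk : k < 2) :
    (c * DirectSum.of (H R) j x) k = 0 ∧ (DirectSum.of (H R) j x * c) k = 0 := by
  induction c using DirectSum.induction_on with
  | zero => simp
  | of i c =>
    rw [DirectSum.of_mul_of, DirectSum.of_mul_of]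
    exact ⟨DirectSum.of_eq_of_ne _ _ _ (by omega), DirectSum.of_eq_of_ne _ _ _ (by omega)⟩
  | add c c' h h' =>
    rw [add_mul, mul_add, DirectSum.add_apply, DirectSum.add_apply, h.1, h.2, h'.1, h'.2]
    simp

theorem mul_apply_of_components {x : HStar R} (hx : ∀ i < 2, x i = 0) (c : HStar R) (k : ℕ)
    (hk : k < 2) : (c * x) k = 0 ∧ (x * c) k = 0 := by
  classical
  have hs : ∀ j ∈ DFinsupp.support x, 2 ≤ j := by
    intro j hj
    by_contra h
    exact (DFinsupp.mem_support_iff.1 hj) (hx j (by omega))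
  rw [← DirectSum.sum_support_of x, Finset.mul_sum, Finset.sum_mul, DFinsupp.finsetSum_apply,
    DFinsupp.finsetSum_apply]
  exact ⟨Finset.sum_eq_zero fun j hj => (of_mul_apply_of_two_le j (hs j hj) _ c k hk).1,
    Finset.sum_eq_zero fun j hj => (of_mul_apply_of_two_le j (hs j hj) _ c k hk).2⟩

variable (R)

/-- The two-sided ideal `⨁_{i ≥ 2} H^i(R)` of `H^*(R)`. -/
def degreeGETwo : Ideal (HStar R) where
  carrier := {x | ∀ i < 2, x i = 0}
  add_mem' hx hy i hi := by rw [DirectSum.add_apply, hx i hi, hy i hi, add_zero]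
  zero_mem' _ _ := rfl
  smul_mem' c _ hx i hi := (mul_apply_of_components hx c i hi).1

instance : (degreeGETwo R).IsTwoSided :=
  ⟨fun c hx i hi => (mul_apply_of_components hx c i hi).2⟩

/-- The quotient ring `H^{≤1}(R) = H^*(R) / ⨁_{i ≥ 2} H^i(R)`. -/
abbrev HLeOne : Type _ := HStar R ⧸ degreeGETwo R

/-- The degree `i` part of `H^{≤1}(R)`: the image of `H^i(R)`; it is zero for `i ≥ 2`. -/
def HLeOne.degree (i : ℕ) : AddSubgroup (HLeOne R) :=
  ((Ideal.Quotient.mk (degreeGETwo R)).toAddMonoidHom.comp (DirectSum.of (H R) i)).range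

/-- The identification of groups `H^{≤1}(R) = H^0(R) ⊕ H^1(R)`. -/
def HLeOne.equivProd : HLeOne R ≃+ H R 0 × H R 1 where
  toFun := QuotientAddGroup.lift (degreeGETwo R).toAddSubgroup
    ((DFinsupp.evalAddMonoidHom 0).prod (DFinsupp.evalAddMonoidHom 1))
    (fun x hx => Prod.ext (hx 0 (by omega)) (hx 1 (by omega)))
  invFun x := Ideal.Quotient.mk _ (DirectSum.of (H R) 0 x.1 + DirectSum.of (H R) 1 x.2)
  left_inv := by
    intro x
    obtain ⟨x, rfl⟩ := Ideal.Quotient.mk_surjective x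
    refine (Ideal.Quotient.eq).2 fun i hi => ?_
    change (DirectSum.of (H R) 0 (x 0) + DirectSum.of (H R) 1 (x 1) - x) i = 0
    rw [DirectSum.sub_apply, DirectSum.add_apply]
    have : i = 0 ∨ i = 1 := by omega
    rcases this with rfl | rfl
    · rw [DirectSum.of_eq_same, DirectSum.of_eq_of_ne _ _ _ (by omega)]; simp
    · rw [DirectSum.of_eq_same, DirectSum.of_eq_of_ne _ _ _ (by omega)]; simp
  right_inv := by
    rintro ⟨a, b⟩
    change ((DirectSum.of (H R) 0 a + DirectSum.of (H R) 1 b) 0,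
      (DirectSum.of (H R) 0 a + DirectSum.of (H R) 1 b) 1) = (a, b)
    rw [DirectSum.add_apply, DirectSum.add_apply, DirectSum.of_eq_same, DirectSum.of_eq_same,
      DirectSum.of_eq_of_ne _ _ _ (by omega), DirectSum.of_eq_of_ne _ _ _ (by omega)]
    simp
  map_add' := map_add _

/-! ### The group `\bar H^1` -/

/-- The group `\overline{Der}(R)` of families `{f(p)}` of endomorphisms indexed by the primes with
`f(p)(R) ⊆ pR` and `ψ^p f(q) + f(p) ψ^q = ψ^q f(p) + f(q) ψ^p`. -/
def DerBar : AddSubgroup (Nat.Primes → Module.End ℤ R) where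
  carrier := {f | (∀ (p : Nat.Primes) (r : R), ((p : ℕ) : R) ∣ f p r) ∧
    ∀ p q : Nat.Primes, psi p * f q + f p * psi q = psi q * f p + f q * psi p}
  add_mem' := by
    rintro f g ⟨hf, hf'⟩ ⟨hg, hg'⟩
    refine ⟨fun p r => dvd_add (hf p r) (hg p r), fun p q => ?_⟩
    have := congrArg₂ (· + ·) (hf' p q) (hg' p q)
    simp only [Pi.add_apply, mul_add, add_mul]
    calc _ = psi p * f q + f p * psi q + (psi p * g q + g p * psi q) := by abel
      _ = _ := this
      _ = _ := by abel
  zero_mem' := ⟨fun _ _ => dvd_zero _, fun p q => by simp⟩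
  neg_mem' := by
    rintro f ⟨hf, hf'⟩
    refine ⟨fun p r => (hf p r).neg_right, fun p q => ?_⟩
    have := congrArg (- ·) (hf' p q)
    simpa only [Pi.neg_apply, mul_neg, neg_mul, neg_add] using this

/-- The homomorphism sending an endomorphism `g` to the family `{[ψ^p, g]}` indexed by the primes,
where `[ψ^p, g] = ψ^p g - g ψ^p`. -/
def adPrimes : Module.End ℤ R →+ (Nat.Primes → Module.End ℤ R) where
  toFun g p := psi p * g - g * psi p
  map_zero' := by ext; simp
  map_add' g g' := by
    funext p
    simp only [Pi.add_apply, mul_add, add_mul]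
    abel

/-- The group `\overline{Inn}(R)` of families `{[ψ^p, g]}` with `g ∈ \overline{End}(R)`. -/
def InnBar : AddSubgroup (Nat.Primes → Module.End ℤ R) :=
  (endBar R).toAddSubgroup.map (adPrimes R)

/-- The group `\bar H^1(R) = \overline{Der}(R) / \overline{Inn}(R)`. -/
def HBarOne : Type _ := DerBar R ⧸ (InnBar R).addSubgroupOf (DerBar R)

instance : AddCommGroup (HBarOne R) :=
  inferInstanceAs (AddCommGroup (DerBar R ⧸ (InnBar R).addSubgroupOf (DerBar R)))

variable {R}

/-- The class `[{f(p)}]` of an element of `\overline{Der}(R)`. -/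
def HBarOne.mk : DerBar R →+ HBarOne R := QuotientAddGroup.mk' _

theorem cocycle_one {f : Coch R 1} (hf : f ∈ Z R 1) (m n : ℕ+) :
    f (fun _ => m * n) = psi m * f (fun _ => n) + f (fun _ => m) * psi n := by
  have h : d 1 f ![m, n] = 0 := congrFun (show d 1 f = 0 from hf.2) _
  have e1 : (fun i : Fin 1 => (![m, n] : Fin 2 → ℕ+) i.succ) = fun _ => n := by
    funext i; fin_cases i; rfl
  have e2 : (fun i : Fin 1 => (![m, n] : Fin 2 → ℕ+) i.castSucc) = fun _ => m := by
    funext i; fin_cases i; rfl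
  have e3 : Fin.contractNth (Fin.castSucc (0 : Fin 1)) (· * ·) (![m, n] : Fin 2 → ℕ+)
      = fun _ => m * n := by
    funext i; fin_cases i; rfl
  rw [d_apply, e1, e2, Fin.sum_univ_one, e3] at h
  have e4 : (![m, n] : Fin 2 → ℕ+) 0 = m := rfl
  have e5 : (![m, n] : Fin 2 → ℕ+) (Fin.last 1) = n := rfl
  rw [e4, e5] at h
  simp only [Fin.val_zero, zero_add, pow_one, neg_smul, one_smul, one_add_one_eq_two, even_two,
    Even.neg_pow, one_pow] at h
  rw [← sub_eq_zero, ← neg_eq_zero, ← h]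
  abel

/-- The restriction map `f ↦ {f(p)}` from `1`-cocycles to `\overline{Der}(R)`. -/
def restrictPrimes : Z R 1 →+ DerBar R where
  toFun f := ⟨fun p => f.1 (fun _ => (p : ℕ+)), fun p r => f.2.1 p r, fun p q => by
    rw [← cocycle_one f.2, ← cocycle_one f.2, mul_comm]⟩
  map_zero' := rfl
  map_add' _ _ := rfl

variable (R)

/-- The map `π : H^1(R) → \bar H^1(R)`, `[f] ↦ [{f(p)}]`. -/
def piMap : H R 1 →+ HBarOne R :=
  H.lift (HBarOne.mk.comp restrictPrimes) (by
    rintro f ⟨g, hg, hgf⟩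
    refine (QuotientAddGroup.eq_zero_iff (restrictPrimes f)).2 ?_
    refine ⟨g default, hg, funext fun p => ?_⟩
    have h := congrFun hgf (fun _ => (p : ℕ+))
    rw [d_apply] at h
    change psi (p : ℕ+) * g default - g default * psi (p : ℕ+) = f.1 (fun _ => (p : ℕ+))
    refine Eq.trans ?_ h
    rw [Subsingleton.elim (fun i : Fin 0 => (p : ℕ+)) default]
    simp [sub_eq_add_neg])

/-- The group `\bar H^{≤1}(R) = H^0(R) ⊕ \bar H^1(R)`. -/
abbrev HBarLeOne : Type _ := H R 0 × HBarOne R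

/-- The grading of `\bar H^{≤1}(R)`, with `H^0(R)` in degree `0` and `\bar H^1(R)` in degree `1`. -/
def HBarLeOne.degree : ℕ → AddSubgroup (HBarLeOne R)
  | 0 => (AddMonoidHom.inl (H R 0) (HBarOne R)).range
  | 1 => (AddMonoidHom.inr (H R 0) (HBarOne R)).range
  | _ + 2 => ⊥

/-- The map `(Id, π) : H^{≤1}(R) → \bar H^{≤1}(R)`. -/
def idPi : HLeOne R →+ HBarLeOne R :=
  ((AddMonoidHom.id (H R 0)).prodMap (piMap R)).comp (HLeOne.equivProd R).toAddMonoidHom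

variable {R}

/-- The endomorphism of `R` underlying a `0`-cocycle. The `0`-cocycles are the elements of
`\overline{End}(R)` that commute with all the Adams operations, and `H^0(R)` is the group of
`0`-cocycles modulo zero. -/
def cocycleEnd (g : Z R 0) : Module.End ℤ R := g.1 default

theorem cocycleEnd_comm (g : Z R 0) (n : ℕ+) : psi n * cocycleEnd g = cocycleEnd g * psi n := by
  have h : d 0 g.1 (fun _ => n) = 0 := congrFun (show d 0 g.1 = 0 from g.2.2) _
  rw [d_apply, Subsingleton.elim (fun i : Fin 0 => n) default] at h
  rw [← sub_eq_zero, ← h]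
  simp [sub_eq_add_neg, cocycleEnd]

/-- The family `{g f(p)}`. -/
def lmulDerBar (g : Z R 0) (f : DerBar R) : DerBar R :=
  ⟨fun p => cocycleEnd g * f.1 p, fun p r => by
    obtain ⟨c, hc⟩ := f.2.1 p r
    rw [Module.End.mul_apply, hc, ← nsmul_eq_mul, map_nsmul, nsmul_eq_mul]
    exact dvd_mul_right _ _, fun p q => by
    rw [← mul_assoc, ← mul_assoc, cocycleEnd_comm, cocycleEnd_comm]
    simp only [mul_assoc, ← mul_add, f.2.2 p q]⟩

/-- The family `{f(p) g}`. -/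
def rmulDerBar (f : DerBar R) (g : Z R 0) : DerBar R :=
  ⟨fun p => f.1 p * cocycleEnd g, fun p r => f.2.1 p _, fun p q => by
    rw [mul_assoc (f.1 p), mul_assoc (f.1 q), ← cocycleEnd_comm, ← cocycleEnd_comm]
    simp only [← mul_assoc, ← add_mul, f.2.2 p q]⟩

end LambdaRing

/-- A structure of unital, associative, graded `ℤ`-algebra on an abelian group `A`, compatible with
a given family of subgroups (the homogeneous parts). -/
@[ext]
structure GradedAlgebraStructure (A : Type*) [AddCommGroup A] (deg : ℕ → AddSubgroup A) where
  mul : A →+ A →+ A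
  one : A
  mul_assoc : ∀ x y z, mul (mul x y) z = mul x (mul y z)
  one_mul : ∀ x, mul one x = x
  mul_one : ∀ x, mul x one = x
  isInternal : DirectSum.IsInternal deg
  one_mem : one ∈ deg 0
  mul_mem : ∀ {i j x y}, x ∈ deg i → y ∈ deg j → mul x y ∈ deg (i + j)

/-! A 1-cocycle is a function `f` on the positive integers with `f(mn) = ψ^m f(n) + f(m) ψ^n`. Since
`ψ^1 = 1` and `ψ^{mn} = ψ^m ψ^n`, this says exactly that `n ↦ (ψ^n, f(n))` is a monoid homomorphism
into the trivial square-zero extension of `End(R)` by itself. The positive integers form the free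
commutative monoid on the primes, so such a homomorphism is the same as a family of pairwise
commuting elements `(ψ^p, f(p))`. Commutation is the relation defining `DerBar`, and the condition
`f(p)(R) ⊆ pR` concerns only primes. Hence `restrictPrimes` is bijective from cocycles to `DerBar`.
It matches the coboundaries of `endBar` with `InnBar`, so `π` is bijective (`piMap_bijective`). The
algebra structure is then transported along `(Id, π)`, and the product formulas follow by lifting a
family to a cocycle.

The substantial input is that the `ψ^n` are multiplicative and compose correctly (`adams_mul`,
`psi_mul`). This uses a weak splitting principle: for fixed `N`, the ring embeds into one where
`λ^k(r)`, `k ≤ N`, are the elementary symmetric functions of elements `v_i` (`exists_esymmEval_eq`);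
the larger ring need not carry a λ-structure. There `ψ^n(r)` becomes `∑ v_i^n` (`map_adams`), and
the universal polynomials take their expected values (`aeval_mulPoly`, `aeval_compPoly`), reducing
both claims to identities of power sums. -/

/-! ### Homogeneous components under weighted substitution -/

open MvPolynomial in
theorem MvPolynomial.IsWeightedHomogeneous.isHomogeneous_aeval {σ τ A : Type*} [CommRing A]
    {w : σ → ℕ} {n : ℕ} {φ : MvPolynomial σ A} (hφ : φ.IsWeightedHomogeneous w n)
    {g : σ → MvPolynomial τ A} (hg : ∀ i, (g i).IsHomogeneous (w i)) :
    (aeval g φ).IsHomogeneous n := by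
  rw [aeval_def, eval₂_eq]
  refine IsHomogeneous.sum _ _ _ fun s hs => ?_
  rw [← zero_add n]
  refine IsHomogeneous.mul (isHomogeneous_C _ _) ?_
  have h : n = ∑ i ∈ s.support, w i * s i := by
    rw [← hφ (mem_support_iff.1 hs), Finsupp.weight_apply, Finsupp.sum]
    exact Finset.sum_congr rfl fun i _ => by rw [smul_eq_mul, mul_comm]
  rw [h]
  exact IsHomogeneous.prod _ _ _ fun i _ => (hg i).pow _

-- Monomials of weight `n` go to forms of degree `n`, so substitution respects the gradings. Thus an
-- expression of a form of degree `n` through elementary symmetric polynomials can be truncated to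
-- its part of weight `n`.
open MvPolynomial in
theorem MvPolynomial.homogeneousComponent_aeval {σ τ A : Type*} [CommRing A]
    (w : σ → ℕ) (n : ℕ) {g : σ → MvPolynomial τ A} (hg : ∀ i, (g i).IsHomogeneous (w i))
    (φ : MvPolynomial σ A) :
    homogeneousComponent n (aeval g φ) = aeval g (weightedHomogeneousComponent w n φ) := by
  induction φ using MvPolynomial.induction_on' with
  | monomial s a =>
    have h := isWeightedHomogeneous_monomial w s a rfl
    rw [weightedHomogeneousComponent_of_mem h, homogeneousComponent_of_mem
      (h.isHomogeneous_aeval hg)]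
    split_ifs <;> simp
  | add p q hp hq => simp only [map_add, hp, hq]

/-- The `k`-th elementary symmetric function of a finite family of elements. -/
def esymmEval {σ A : Type*} [Fintype σ] [CommRing A] (v : σ → A) (k : ℕ) : A :=
  ∑ t ∈ Finset.powersetCard k (Finset.univ : Finset σ), ∏ i ∈ t, v i

/-! ### Elementary symmetric functions of a finite family -/

section esymmEval

variable {σ τ A B : Type*} [Fintype σ] [Fintype τ] [CommRing A] [CommRing B]

theorem map_esymmEval (φ : A →+* B) (v : σ → A) (k : ℕ) :
    φ (esymmEval v k) = esymmEval (fun i => φ (v i)) k := by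
  simp [esymmEval, map_sum, map_prod]

theorem aeval_esymm [Algebra B A] (v : σ → A) (k : ℕ) :
    MvPolynomial.aeval v (MvPolynomial.esymm σ B k) = esymmEval v k := by
  simp [MvPolynomial.esymm, esymmEval, map_sum, map_prod]

theorem esymm_eq_esymmEval (k : ℕ) :
    MvPolynomial.esymm σ A k = esymmEval MvPolynomial.X k := rfl

theorem esymmEval_zero (v : σ → A) : esymmEval v 0 = 1 := by simp [esymmEval]

/-- The generating product makes reindexing and the omission of zero entries evident. -/
theorem coeff_prod_one_add_C_mul_X (v : σ → A) (k : ℕ) :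
    (∏ i, (1 + Polynomial.C (v i) * Polynomial.X)).coeff k = esymmEval v k := by
  have h : ∀ t : Finset σ, ∏ i ∈ t, Polynomial.C (v i) * Polynomial.X =
      Polynomial.C (∏ i ∈ t, v i) * Polynomial.X ^ t.card := by
    intro t
    rw [Finset.prod_mul_distrib, Finset.prod_const, map_prod]
  rw [Finset.prod_one_add, Polynomial.finsetSum_coeff, esymmEval, Finset.powersetCard_eq_filter,
    Finset.sum_filter]
  refine Finset.sum_congr rfl fun t _ => ?_
  rw [h, Polynomial.coeff_C_mul_X_pow]
  exact if_congr eq_comm rfl rfl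

/-- Entries that are zero do not contribute to the elementary symmetric functions. -/
theorem esymmEval_of_injective (f : τ → σ) (hf : Function.Injective f) (v : σ → A)
    (hv : ∀ i ∉ Set.range f, v i = 0) (k : ℕ) :
    esymmEval v k = esymmEval (fun j => v (f j)) k := by
  rw [← coeff_prod_one_add_C_mul_X, ← coeff_prod_one_add_C_mul_X]
  congr 1
  exact (Fintype.prod_of_injective f hf _ _ (fun i hi => by rw [hv i hi]; simp)
    fun _ => rfl).symm

theorem esymmEval_comp_equiv (e : τ ≃ σ) (v : σ → A) (k : ℕ) :
    esymmEval (fun j => v (e j)) k = esymmEval v k :=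
  (esymmEval_of_injective e e.injective v (fun i hi => (hi (e.surjective i)).elim) k).symm

theorem isHomogeneous_esymmEval {ι : Type*} {v : σ → MvPolynomial ι A} {a : ℕ}
    (hv : ∀ i, (v i).IsHomogeneous a) (k : ℕ) : (esymmEval v k).IsHomogeneous (k * a) := by
  refine MvPolynomial.IsHomogeneous.sum _ _ _ fun t ht => ?_
  have := MvPolynomial.IsHomogeneous.prod t v (fun _ => a) fun i _ => hv i
  rwa [Finset.sum_const, (Finset.mem_powersetCard.1 ht).2, smul_eq_mul] at this

/-- Newton's identity for power sums, in the shape of the recurrence `newton` that defines the Adams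
operations. -/
theorem natCast_mul_esymmEval (v : σ → A) (k : ℕ) :
    (k : A) * esymmEval v k = (-1) ^ (k + 1) *
      ∑ j ∈ Finset.range k, (-1) ^ j * esymmEval v j * ∑ i, v i ^ (k - j) := by
  have h := congrArg (MvPolynomial.aeval (R := ℤ) v) (MvPolynomial.mul_esymm_eq_sum σ ℤ k)
  simp only [map_mul, map_natCast, map_sum, map_pow, map_neg, map_one, aeval_esymm,
    MvPolynomial.psum, MvPolynomial.aeval_X] at h
  rw [h, Finset.sum_filter, Finset.Nat.sum_antidiagonal_eq_sum_range_succ_mk,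
    Finset.sum_range_succ, if_neg (lt_irrefl _), add_zero]
  congr 1
  exact Finset.sum_congr rfl fun j hj => if_pos (Finset.mem_range.1 hj)

end esymmEval

/-- After an injective extension of the ring, prescribed elements are the first elementary
symmetric functions of some elements. -/
theorem exists_esymmEval_eq.{u} {A : Type u} [CommRing A] (c : ℕ → A) (hc : c 0 = 1) (N : ℕ) :
    ∃ (B : Type u) (_ : CommRing B) (φ : A →+* B) (v : Fin N → B),
      Function.Injective φ ∧ ∀ k ≤ N, φ (c k) = esymmEval v k := by
  -- The degree computations below need a nontrivial ring; over the zero ring every equation holds.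
  rcases subsingleton_or_nontrivial A with hA | hA
  · exact ⟨A, inferInstance, RingHom.id A, 0, fun _ _ h => h, fun _ _ => Subsingleton.elim _ _⟩
  -- The coefficient of `X^(N-k)` is `c k`, as it must be for a product `∏ (X + v_i)` with
  -- elementary symmetric functions `c k`; `c 0 = 1` matches the leading coefficient.
  let p : Polynomial A := Polynomial.X ^ N +
    ∑ k : Fin N, Polynomial.C (c (N - k)) * Polynomial.X ^ (k : ℕ)
  have hdeg : (∑ k : Fin N, Polynomial.C (c (N - k)) * Polynomial.X ^ (k : ℕ)).degree < (N : WithBot ℕ) :=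
    Polynomial.degree_sum_fin_lt fun k : Fin N => c (N - k)
  have hp : p.Monic := Polynomial.monic_X_pow_add hdeg
  have hpd : p.natDegree = N := by
    refine Polynomial.natDegree_eq_of_degree_eq_some ?_
    rw [Polynomial.degree_add_eq_left_of_degree_lt, Polynomial.degree_X_pow]
    rwa [Polynomial.degree_X_pow]
  have hpc : ∀ k ≤ N, p.coeff k = c (N - k) := by
    intro k hk
    rw [Polynomial.coeff_add, Polynomial.coeff_X_pow, Polynomial.finsetSum_coeff]
    simp only [Polynomial.coeff_C_mul_X_pow]
    rcases hk.lt_or_eq with hk | rfl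
    · rw [if_neg hk.ne, zero_add, Finset.sum_eq_single ⟨k, hk⟩]
      · simp
      · intro j _ hj
        exact if_neg fun e => hj (Fin.ext e.symm)
      · simp
    · rw [if_pos rfl, Finset.sum_eq_zero, Nat.sub_self, hc, add_zero]
      intro j _
      exact if_neg j.2.ne'
  obtain ⟨B, _, _, _, _, _, hB⟩ := hp.exists_splits_map
  -- The factors are taken as `X + a` rather than `X - a`, so no signs appear in the coefficients.
  obtain ⟨m, hm⟩ := Polynomial.splits_iff_exists_multiset'.1 hB
  rw [(hp.map _).leadingCoeff, map_one, one_mul] at hm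
  have hcard : m.card = N := by
    have := congrArg Polynomial.natDegree hm
    rw [hp.natDegree_map, hpd, Polynomial.natDegree_multiset_prod_of_monic _ (by
      simpa using fun a _ => Polynomial.monic_X_add_C a), Multiset.map_map] at this
    simp at this
    exact this.symm
  obtain ⟨v, hv⟩ : ∃ v : Fin N → B, (Finset.univ : Finset (Fin N)).val.map v = m := by
    subst hcard
    induction m using Quotient.inductionOn with
    | h l => exact ⟨fun i => l.get i, by
        rw [Fin.univ_val_map]
        exact congrArg Multiset.ofList (List.ofFn_get l)⟩
  refine ⟨B, inferInstance, algebraMap A B, v, FaithfulSMul.algebraMap_injective A B,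
    fun k hk => ?_⟩
  have h1 := Multiset.prod_X_add_C_coeff m (k := N - k) (by omega)
  rw [← hm, Polynomial.coeff_map, hpc _ (by omega), hcard, Nat.sub_sub_self hk, ← hv,
    Finset.esymm_map_val] at h1
  exact h1

open MvPolynomial in
/-- If a symmetric homogeneous polynomial of degree `d` is expressed, after all but `d` variables
are set to zero, through the elementary symmetric polynomials, then the same expression is
valid without setting any variables to zero. -/
theorem aeval_esymmEval_of_restrict {A : Type*} [CommRing A] {d N : ℕ} (h : d ≤ N)
    (P : MvPolynomial (Fin d) A) (Q : MvPolynomial (Fin N) A) (hs : Q.IsSymmetric)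
    (hh : Q.IsHomogeneous d)
    (hr : aeval (fun k : Fin d => esymmEval (X : Fin d → MvPolynomial (Fin d) A) (k + 1)) P =
      aeval (Function.extend (Fin.castLE h) (X : Fin d → MvPolynomial (Fin d) A) 0) Q)
    (v : Fin N → A) :
    aeval (fun k : Fin d => esymmEval v (k + 1)) P = aeval v Q := by
  obtain ⟨P₀, hP₀⟩ := esymmAlgHom_surjective (σ := Fin N) A (n := N) (by simp) ⟨Q, hs⟩
  replace hP₀ : aeval (fun k : Fin N => esymm (Fin N) A (k + 1)) P₀ = Q := by
    rw [← esymmAlgHom_apply, hP₀]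
  set w : Fin N → ℕ := fun k => k + 1
  have hw : ∀ k : Fin N, (esymm (Fin N) A (k + 1)).IsHomogeneous (w k) := fun k => by
    have := isHomogeneous_esymmEval (A := A) (fun i : Fin N => isHomogeneous_X A i) (k + 1)
    rwa [mul_one] at this
  -- Since `Q` is homogeneous of degree `d`, only the weight `d` part of `P₀` matters, where the
  -- `k`-th elementary symmetric polynomial has weight `k`.
  have hP₁ := homogeneousComponent_aeval w d hw P₀
  rw [hP₀, homogeneousComponent_eq_self hh] at hP₁
  have hcast : Function.Injective (Fin.castLE h) := Fin.castLE_injective h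
  -- A monomial of weight `d` contains no variable of weight above `d`, so this part lives in the
  -- first `d` variables.
  obtain ⟨P₂, hP₂⟩ := exists_rename_eq_of_vars_subset_range (weightedHomogeneousComponent w d P₀)
    (Fin.castLE h) hcast (by
      intro k hk
      obtain ⟨s, hs, hks⟩ := (mem_vars_iff_mem_support _).1 hk
      have h1 := weightedHomogeneousComponent_isWeightedHomogeneous (w := w) d P₀
        (mem_support_iff.1 hs)
      have h2 : w k ≤ Finsupp.weight w s := Finsupp.le_weight_of_ne_zero' w (Finsupp.mem_support_iff.1 hks)
      have h3 : (k : ℕ) + 1 ≤ d := h1 ▸ h2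
      exact ⟨⟨k, h3⟩, rfl⟩)
  rw [← hP₂, aeval_rename] at hP₁
  -- With the extra variables set to zero, both polynomials express the same element through the `d`
  -- elementary symmetric polynomials, which are algebraically independent.
  have hP₂P : P₂ = P := by
    apply esymmAlgHom_injective (σ := Fin d) A (n := d) (by simp)
    apply Subtype.ext
    rw [esymmAlgHom_apply, esymmAlgHom_apply]
    simp only [esymm_eq_esymmEval]
    rw [hr, hP₁, ← AlgHom.comp_apply, comp_aeval]
    congr 2
    funext k
    simp only [Function.comp_apply, aeval_esymm]
    rw [esymmEval_of_injective (Fin.castLE h) hcast]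
    · simp [hcast.extend_apply]
    · intro i hi
      exact Function.extend_apply' _ _ _ hi
  rw [hP₁, ← hP₂P, ← AlgHom.comp_apply, comp_aeval]
  congr 2
  funext k
  simp only [Function.comp_apply, aeval_esymm]
  rfl

/-! ### Values of the universal polynomials on families of any sufficient length -/

section universalPolynomials

open MvPolynomial

variable {A : Type*} [CommRing A]

theorem map_aeval_int {τ B : Type*} [CommRing B] (φ : B →+* A) (g : τ → B)
    (P : MvPolynomial τ ℤ) : φ (aeval g P) = aeval (fun k => φ (g k)) P :=
  comp_aeval_apply g φ.toIntAlgHom P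

theorem aeval_mulPoly_self {i : ℕ} (v w : Fin i → A) :
    aeval (Sum.elim (fun k : Fin i => esymmEval v (k + 1)) (fun k : Fin i => esymmEval w (k + 1)))
      (mulPoly i) = esymmEval (fun x : Fin i × Fin i => v x.1 * w x.2) i := by
  have hspec : aeval (Sum.elim
      (fun k : Fin i => rename Sum.inl (esymm (Fin i) ℤ (k + 1)))
      (fun k : Fin i => rename Sum.inr (esymm (Fin i) ℤ (k + 1)))) (mulPoly i) = _ :=
    (exists_mulPoly i).choose_spec
  rw [← Fintype.prod_prod_type' (f := fun m n => 1 + Polynomial.C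
    (X (Sum.inl m) * X (Sum.inr n) : MvPolynomial (Fin i ⊕ Fin i) ℤ) * Polynomial.X),
    coeff_prod_one_add_C_mul_X] at hspec
  have h := (map_aeval_int (aeval (R := ℤ) (Sum.elim v w)).toRingHom _ _).symm.trans
    (congrArg (aeval (R := ℤ) (Sum.elim v w)).toRingHom hspec)
  rw [map_esymmEval] at h
  simp only [AlgHom.toRingHom_eq_coe, RingHom.coe_coe, map_mul, aeval_X, Sum.elim_inl,
    Sum.elim_inr] at h
  rw [← h]
  congr 2
  funext k
  rcases k with k | k <;> simp [aeval_rename, aeval_esymm, Function.comp_def]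

/-- The stability lemma handles one family at a time: here `w` is kept as constant coefficients
while the first family grows from `i` to `N` members. -/
theorem aeval_mulPoly_left {i N : ℕ} (hi : i ≤ N) (v : Fin N → A) (w : Fin i → A) :
    aeval (Sum.elim (fun k : Fin i => esymmEval v (k + 1)) (fun k : Fin i => esymmEval w (k + 1)))
      (mulPoly i) = esymmEval (fun x : Fin N × Fin i => v x.1 * w x.2) i := by
  have h := aeval_esymmEval_of_restrict hi
    (aeval (Sum.elim X (fun k : Fin i => C (esymmEval w (k + 1)))) (mulPoly i))
    (esymmEval (fun x : Fin N × Fin i => X x.1 * C (w x.2)) i) ?_ ?_ ?_ v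
  · have h2 := map_esymmEval (aeval (R := A) v).toRingHom
      (fun x : Fin N × Fin i => (X x.1 * C (w x.2) : MvPolynomial (Fin N) A)) i
    simp only [AlgHom.toRingHom_eq_coe, RingHom.coe_coe, map_mul, aeval_X, aeval_C,
      Algebra.algebraMap_self, RingHom.id_apply] at h2
    rw [← h2, ← h]
    refine Eq.trans ?_ (map_aeval_int (AlgHom.toRingHom _) _ _).symm
    congr 2
    funext k
    rcases k with k | k <;> simp
  · intro e
    have h2 := map_esymmEval (rename (R := A) e).toRingHom
      (fun x : Fin N × Fin i => (X x.1 * C (w x.2) : MvPolynomial (Fin N) A)) i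
    simp only [AlgHom.toRingHom_eq_coe, RingHom.coe_coe, map_mul, rename_X, rename_C] at h2
    rw [h2]
    exact esymmEval_comp_equiv (e.prodCongr (Equiv.refl (Fin i)))
      (fun x : Fin N × Fin i => (X x.1 * C (w x.2) : MvPolynomial (Fin N) A)) i
  · have := isHomogeneous_esymmEval (A := A) (a := 1)
      (v := fun x : Fin N × Fin i => (X x.1 * C (w x.2) : MvPolynomial (Fin N) A))
      (fun x => (isHomogeneous_X A x.1).mul (isHomogeneous_C _ _)) i
    rwa [mul_one] at this
  · have h2 := map_esymmEval (aeval (R := A)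
      (Function.extend (Fin.castLE hi) (X : Fin i → MvPolynomial (Fin i) A) 0)).toRingHom
      (fun x : Fin N × Fin i => (X x.1 * C (w x.2) : MvPolynomial (Fin N) A)) i
    simp only [AlgHom.toRingHom_eq_coe, RingHom.coe_coe, map_mul, aeval_X, aeval_C,
      algebraMap_eq] at h2
    have hcast : Function.Injective (Fin.castLE hi) := Fin.castLE_injective hi
    rw [h2, esymmEval_of_injective (Prod.map (Fin.castLE hi) id)
      (hcast.prodMap Function.injective_id)]
    · simp only [Prod.map_fst, Prod.map_snd, hcast.extend_apply, id]
      rw [← aeval_mulPoly_self X (fun n => C (w n))]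
      refine (map_aeval_int (AlgHom.toRingHom _) _ _).trans ?_
      congr 2
      funext k
      rcases k with k | k <;> simp [← map_esymmEval (C : A →+* MvPolynomial (Fin i) A)]
    · rintro ⟨x, y⟩ hx
      rw [Function.extend_apply', Pi.zero_apply, zero_mul]
      rintro ⟨x', rfl⟩
      exact hx ⟨(x', y), rfl⟩

/-- The second family is lengthened in the same way, with the first, already of length `N`, now held
constant. -/
theorem aeval_mulPoly {i N : ℕ} (hi : i ≤ N) (v w : Fin N → A) :
    aeval (Sum.elim (fun k : Fin i => esymmEval v (k + 1)) (fun k : Fin i => esymmEval w (k + 1)))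
      (mulPoly i) = esymmEval (fun x : Fin N × Fin N => v x.1 * w x.2) i := by
  have h := aeval_esymmEval_of_restrict hi
    (aeval (Sum.elim (fun k : Fin i => C (esymmEval v (k + 1))) X) (mulPoly i))
    (esymmEval (fun x : Fin N × Fin N => C (v x.1) * X x.2) i) ?_ ?_ ?_ w
  · have h2 := map_esymmEval (aeval (R := A) w).toRingHom
      (fun x : Fin N × Fin N => (C (v x.1) * X x.2 : MvPolynomial (Fin N) A)) i
    simp only [AlgHom.toRingHom_eq_coe, RingHom.coe_coe, map_mul, aeval_X, aeval_C,
      Algebra.algebraMap_self, RingHom.id_apply] at h2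
    rw [← h2, ← h]
    refine Eq.trans ?_ (map_aeval_int (AlgHom.toRingHom _) _ _).symm
    congr 2
    funext k
    rcases k with k | k <;> simp
  · intro e
    have h2 := map_esymmEval (rename (R := A) e).toRingHom
      (fun x : Fin N × Fin N => (C (v x.1) * X x.2 : MvPolynomial (Fin N) A)) i
    simp only [AlgHom.toRingHom_eq_coe, RingHom.coe_coe, map_mul, rename_X, rename_C] at h2
    rw [h2]
    exact esymmEval_comp_equiv ((Equiv.refl (Fin N)).prodCongr e)
      (fun x : Fin N × Fin N => (C (v x.1) * X x.2 : MvPolynomial (Fin N) A)) i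
  · have := isHomogeneous_esymmEval (A := A) (a := 1)
      (v := fun x : Fin N × Fin N => (C (v x.1) * X x.2 : MvPolynomial (Fin N) A))
      (fun x => (isHomogeneous_X A x.2).C_mul _) i
    rwa [mul_one] at this
  · have h2 := map_esymmEval (aeval (R := A)
      (Function.extend (Fin.castLE hi) (X : Fin i → MvPolynomial (Fin i) A) 0)).toRingHom
      (fun x : Fin N × Fin N => (C (v x.1) * X x.2 : MvPolynomial (Fin N) A)) i
    simp only [AlgHom.toRingHom_eq_coe, RingHom.coe_coe, map_mul, aeval_X, aeval_C,
      algebraMap_eq] at h2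
    have hcast : Function.Injective (Fin.castLE hi) := Fin.castLE_injective hi
    rw [h2, esymmEval_of_injective (Prod.map id (Fin.castLE hi))
      (Function.injective_id.prodMap hcast)]
    · simp only [Prod.map_fst, Prod.map_snd, hcast.extend_apply, id]
      rw [← aeval_mulPoly_left hi (fun n => C (v n)) X]
      refine (map_aeval_int (AlgHom.toRingHom _) _ _).trans ?_
      congr 2
      funext k
      rcases k with k | k <;> simp [← map_esymmEval (C : A →+* MvPolynomial (Fin i) A)]
    · rintro ⟨x, y⟩ hx
      rw [Function.extend_apply', Pi.zero_apply, mul_zero]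
      rintro ⟨y', rfl⟩
      exact hx ⟨(x, y'), rfl⟩

theorem aeval_compPoly_self {i j : ℕ} (v : Fin (i * j) → A) :
    aeval (fun k : Fin (i * j) => esymmEval v (k + 1)) (compPoly i j) =
      esymmEval (fun S : {S : Finset (Fin (i * j)) // S.card = j} => ∏ l ∈ S.1, v l) i := by
  have hspec : aeval (fun k : Fin (i * j) => esymm (Fin (i * j)) ℤ (k + 1)) (compPoly i j) = _ :=
    (exists_compPoly i j).choose_spec
  rw [Finset.prod_subtype (p := fun S : Finset (Fin (i * j)) => S.card = j) _
    (fun S => by simp [Finset.mem_powersetCard]), coeff_prod_one_add_C_mul_X] at hspec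
  have h := (map_aeval_int (aeval (R := ℤ) v).toRingHom _ _).symm.trans
    (congrArg (aeval (R := ℤ) v).toRingHom hspec)
  rw [map_esymmEval] at h
  simp only [AlgHom.toRingHom_eq_coe, RingHom.coe_coe, map_prod, aeval_X] at h
  rw [← h]
  congr 2
  funext k
  simp [aeval_esymm]

/-- The `i`-th elementary symmetric function of the `j`-fold products is symmetric and homogeneous
of degree `ij`, so the defining identity in `ij` variables extends to `N`. -/
theorem aeval_compPoly {i j N : ℕ} (hN : i * j ≤ N) (v : Fin N → A) :
    aeval (fun k : Fin (i * j) => esymmEval v (k + 1)) (compPoly i j) =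
      esymmEval (fun S : {S : Finset (Fin N) // S.card = j} => ∏ l ∈ S.1, v l) i := by
  have h := aeval_esymmEval_of_restrict hN (aeval X (compPoly i j))
    (esymmEval (fun S : {S : Finset (Fin N) // S.card = j} => ∏ l ∈ S.1, X l) i) ?_ ?_ ?_ v
  · have h2 := map_esymmEval (aeval (R := A) v).toRingHom
      (fun S : {S : Finset (Fin N) // S.card = j} =>
        (∏ l ∈ S.1, X l : MvPolynomial (Fin N) A)) i
    simp only [AlgHom.toRingHom_eq_coe, RingHom.coe_coe, map_prod, aeval_X] at h2
    rw [← h2, ← h]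
    refine Eq.trans ?_ (map_aeval_int (AlgHom.toRingHom _) _ _).symm
    congr 2
    funext k
    simp
  · intro e
    have h2 := map_esymmEval (rename (R := A) e).toRingHom
      (fun S : {S : Finset (Fin N) // S.card = j} =>
        (∏ l ∈ S.1, X l : MvPolynomial (Fin N) A)) i
    simp only [AlgHom.toRingHom_eq_coe, RingHom.coe_coe, map_prod, rename_X] at h2
    rw [h2, ← esymmEval_comp_equiv (e.finsetCongr.subtypeEquiv (p := fun S => S.card = j)
      (q := fun S => S.card = j) (fun S => by simp))
      (fun S : {S : Finset (Fin N) // S.card = j} =>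
        (∏ l ∈ S.1, X l : MvPolynomial (Fin N) A))]
    congr 1
    funext S
    simp
  · exact isHomogeneous_esymmEval (A := A) (a := j)
      (v := fun S : {S : Finset (Fin N) // S.card = j} =>
        (∏ l ∈ S.1, X l : MvPolynomial (Fin N) A))
      (fun S => by
        have := IsHomogeneous.prod S.1 (fun l => (X l : MvPolynomial (Fin N) A)) (fun _ => 1)
          fun l _ => isHomogeneous_X A l
        simpa [S.2] using this) i
  · have h2 := map_esymmEval (aeval (R := A)
      (Function.extend (Fin.castLE hN) (X : Fin (i * j) → MvPolynomial (Fin (i * j)) A) 0)).toRingHom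
      (fun S : {S : Finset (Fin N) // S.card = j} =>
        (∏ l ∈ S.1, X l : MvPolynomial (Fin N) A)) i
    simp only [AlgHom.toRingHom_eq_coe, RingHom.coe_coe, map_prod, aeval_X] at h2
    have hcast : Function.Injective (Fin.castLE hN) := Fin.castLE_injective hN
    rw [h2, esymmEval_of_injective
      (fun S : {S : Finset (Fin (i * j)) // S.card = j} =>
        (⟨S.1.map ⟨Fin.castLE hN, hcast⟩, by simp [S.2]⟩ : {S : Finset (Fin N) // S.card = j}))
      (fun S T hST => Subtype.ext (Finset.map_injective _ (congrArg Subtype.val hST)))]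
    · simp only [Finset.prod_map, Function.Embedding.coeFn_mk, hcast.extend_apply]
      rw [← aeval_compPoly_self X]
      refine (map_aeval_int (AlgHom.toRingHom _) _ _).trans ?_
      congr 2
      funext k
      simp
    · rintro ⟨S, hS⟩ hx
      -- A product over `S` that survives the restriction uses only the first `ij` indices, so `S`
      -- comes from a subset of `Fin (i * j)`.
      by_contra hne
      have hmem : ∀ l ∈ S, l ∈ Set.range (Fin.castLE hN) := by
        intro l hl
        by_contra hl'
        exact hne (Finset.prod_eq_zero hl (Function.extend_apply' _ _ _ hl'))
      obtain ⟨T, rfl⟩ : ∃ T : Finset (Fin (i * j)), T.map ⟨Fin.castLE hN, hcast⟩ = S := by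
        refine ⟨S.preimage (Fin.castLE hN) hcast.injOn, ?_⟩
        ext l
        simp only [Finset.mem_map, Finset.mem_preimage, Function.Embedding.coeFn_mk]
        constructor
        · rintro ⟨a, ha, rfl⟩; exact ha
        · intro hl
          obtain ⟨a, rfl⟩ := hmem l hl
          exact ⟨a, hl, rfl⟩
      exact hx ⟨⟨T, by simpa using hS⟩, rfl⟩

end universalPolynomials

namespace LambdaRing

/-! ### Multiplicativity and composition of the Adams operations -/

section AdamsProperties

variable {R : Type*} [CommRing R] [LambdaRing R]

/-- If `λ^k(r)`, `k ≤ n`, are the elementary symmetric functions of a finite family, then `ψ^n(r)`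
is the sum of the `n`-th powers of its members. -/
theorem map_adams {B σ : Type*} [CommRing B] [Fintype σ] (φ : R →+* B) (v : σ → B) (r : R) (n : ℕ)
    (hn : 0 < n) (h : ∀ k ≤ n, φ (lam k r) = esymmEval v k) :
    φ (adams n r) = ∑ i, v i ^ n := by
  induction n using Nat.strong_induction_on with
  | _ n ih =>
    obtain ⟨n, rfl⟩ : ∃ m, n = m + 1 := ⟨n - 1, by omega⟩
    have h1 := congrArg φ (newton (n + 1) r)
    simp only [map_add, map_sum, map_mul, map_pow, map_neg, map_one, map_natCast, map_zero] at h1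
    have h2 := natCast_mul_esymmEval v (n + 1)
    -- The term `k = 0` is the only one containing the top Adams operation, respectively the top
    -- power sum; all the others agree by induction.
    rw [Finset.sum_range_succ'] at h1 h2
    rw [h (n + 1) le_rfl, mul_assoc ((-1) ^ (n + 1)), h2, ← mul_assoc, ← pow_add,
      Odd.neg_one_pow (n := n + 1 + (n + 1 + 1)) ⟨n + 1, by ring⟩, h 0 (Nat.zero_le _)] at h1
    have h3 : ∀ k ∈ Finset.range n, (-1) ^ (k + 1) * φ (lam (k + 1) r) *
        φ (adams (n + 1 - (k + 1)) r) =
        (-1) ^ (k + 1) * esymmEval v (k + 1) * ∑ i, v i ^ (n + 1 - (k + 1)) := by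
      intro k hk
      have hk' := Finset.mem_range.1 hk
      rw [h (k + 1) (by omega), ih _ (by omega) (by omega) fun j hj => h j (by omega)]
    rw [Finset.sum_congr rfl h3, esymmEval_zero] at h1
    simp only [pow_zero, one_mul, Nat.sub_zero] at h1
    linear_combination h1

theorem adams_one_left (r : R) : adams 1 r = r := by
  have h := newton 1 r
  simp [lam_zero, lam_one] at h
  linear_combination h

/-- The `λ^k(1)` are the elementary symmetric functions of the one-member family `(1)`. -/
theorem adams_one (n : ℕ) (hn : 0 < n) : adams n (1 : R) = 1 := by
  have h := map_adams (RingHom.id R) (fun _ : Fin 1 => (1 : R)) 1 n hn fun k _ => by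
    rcases k with _ | _ | k
    · simp [lam_zero, esymmEval_zero]
    · simp [lam_one, esymmEval]
    · rw [lam_apply_one _ (by omega), map_zero, esymmEval,
        Finset.powersetCard_eq_empty.2 (by simp), Finset.sum_empty]
  simpa using h

/-- After splitting `r` and `s` into `v_i` and `w_j`, the `λ^k(rs)` are the elementary symmetric
functions of the products `v_i w_j`, whose power sums factor. -/
theorem adams_mul (n : ℕ) (hn : 0 < n) (r s : R) : adams n (r * s) = adams n r * adams n s := by
  obtain ⟨B, _, φ, v, hφ, hv⟩ := exists_esymmEval_eq (fun k => lam k r) (lam_zero r) n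
  -- The element `s` is split over the ring already splitting `r`, so that both families live in
  -- `B'`.
  obtain ⟨B', _, φ', w, hφ', hw⟩ := exists_esymmEval_eq (fun k => φ (lam k s))
    (by rw [lam_zero, map_one]) n
  have hr : ∀ k ≤ n, (φ'.comp φ) (lam k r) = esymmEval (fun i => φ' (v i)) k := fun k hk => by
    rw [RingHom.comp_apply, hv k hk, map_esymmEval]
  have hs : ∀ k ≤ n, (φ'.comp φ) (lam k s) = esymmEval w k := hw
  apply hφ'.comp hφ
  rw [← RingHom.coe_comp]
  rw [map_mul, map_adams _ _ r n hn hr, map_adams _ _ s n hn hs,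
    map_adams _ (fun x : Fin n × Fin n => φ' (v x.1) * w x.2) (r * s) n hn, Finset.sum_mul_sum,
    Fintype.sum_prod_type]
  · simp only [mul_pow]
  · intro k hk
    rw [lam_mul, map_aeval_int, ← aeval_mulPoly hk (fun i => φ' (v i)) w]
    congr 2
    funext i
    rcases i with i | i
    · exact hr _ (by omega)
    · exact hs _ (by omega)

/-- The Adams operation `ψ^n`, `n ≥ 1`, as a ring endomorphism. -/
def psiRingHom (n : ℕ+) : R →+* R where
  toFun := adams n
  map_one' := adams_one n n.pos
  map_mul' := adams_mul n n.pos
  map_zero' := (psi n).map_zero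
  map_add' := adams_add n

/-- If `r` splits into `v_l`, then `λ^j(r)` splits into the `j`-fold products, so `ψ^m(λ^j(r))`
becomes the `j`-th elementary symmetric function of the `v_l^m`. As `ψ^m` is a ring homomorphism,
Newton's formula then yields `ψ^m(ψ^n(r)) = ∑ v_l^{mn}`. -/
theorem psi_mul (m n : ℕ+) : (psi (m * n) : Module.End ℤ R) = psi m * psi n := by
  ext r
  change adams ((m * n : ℕ+) : ℕ) r = psiRingHom m (adams n r)
  -- Length `m * n` suffices both for `ψ^{mn}` and for `λ^i(λ^j(r))` with `i ≤ m`, `j ≤ n`.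
  obtain ⟨B, _, φ, v, hφ, hv⟩ := exists_esymmEval_eq (fun k => lam k r) (lam_zero r) (m * n)
  apply hφ
  rw [PNat.mul_coe, map_adams φ v r _ (Nat.mul_pos m.pos n.pos) hv, ← RingHom.comp_apply,
    -- The homomorphism is `φ ∘ ψ^m`, which need not be injective, and the family is that of the
    -- `m`-th powers.
    map_adams (φ.comp (psiRingHom m)) (fun i => v i ^ (m : ℕ)) r n n.pos]
  · simp only [pow_mul]
  · intro j hj
    change φ (adams m (lam j r)) = _
    rw [map_adams φ (fun S : {S : Finset (Fin (m * n)) // S.card = j} => ∏ l ∈ S.1, v l) _ m m.pos]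
    · rw [esymmEval, Finset.sum_subtype (F := inferInstance) (p := fun S : Finset (Fin (m * n)) => S.card = j)
        (Finset.powersetCard j Finset.univ) (fun S => by simp [Finset.mem_powersetCard])]
      simp only [Finset.prod_pow]
    · intro i hi
      have hij : i * j ≤ m * n := Nat.mul_le_mul hi hj
      rw [lam_lam, map_aeval_int, ← aeval_compPoly hij]
      congr 2
      funext k
      exact hv _ (by omega)

theorem psi_one : (psi 1 : Module.End ℤ R) = 1 := LinearMap.ext adams_one_left

end AdamsProperties

end LambdaRing

/-! ### Positive integers as the free commutative monoid on the primes -/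

open scoped IsMulCommutative in
/-- The multiplicative monoid of positive integers is freely generated by the primes as a
commutative monoid: existence of homomorphisms. -/
theorem PNat.exists_monoidHom_of_primes {M : Type*} [Monoid M] (x : Nat.Primes → M)
    (hx : ∀ p q, x p * x q = x q * x p) :
    ∃ φ : ℕ+ →* M, ∀ p : Nat.Primes, φ (p : ℕ+) = x p := by
  -- The monoid `M` itself need not be commutative; products over multisets of primes are formed in
  -- the commutative submonoid generated by the `x p`.
  have := Submonoid.isMulCommutative_closure M (s := Set.range x) (by
    rintro _ ⟨p, rfl⟩ _ ⟨q, rfl⟩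
    exact hx p q)
  let y : Nat.Primes → Submonoid.closure (Set.range x) :=
    fun p => ⟨x p, Submonoid.subset_closure ⟨p, rfl⟩⟩
  let φ : ℕ+ →* Submonoid.closure (Set.range x) :=
    { toFun := fun n => (Multiset.map y n.factorMultiset).prod
      map_one' := by
        rw [PNat.factorMultiset_one]
        rfl
      map_mul' := fun m n => by
        rw [PNat.factorMultiset_mul]
        exact (congrArg Multiset.prod (Multiset.map_add y _ _)).trans (Multiset.prod_add _ _) }
  refine ⟨(Submonoid.subtype _).comp φ, fun p => ?_⟩
  change (((Multiset.map y (p : ℕ+).factorMultiset).prod : Submonoid.closure (Set.range x)) : M) = _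
  rw [PNat.factorMultiset_ofPrime]
  change (((Multiset.map y {p}).prod : Submonoid.closure (Set.range x)) : M) = _
  rw [Multiset.map_singleton, Multiset.prod_singleton]

/-- A homomorphism from the multiplicative monoid of positive integers is determined by its values
at the primes. -/
theorem PNat.monoidHom_ext_primes {M : Type*} [Monoid M] {φ χ : ℕ+ →* M}
    (h : ∀ p : Nat.Primes, φ (p : ℕ+) = χ (p : ℕ+)) : φ = χ := by
  have key : ∀ n : ℕ, ∀ hn : 0 < n, φ ⟨n, hn⟩ = χ ⟨n, hn⟩ := by
    intro n
    induction n using Nat.recOnMul with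
    | zero => exact fun hn => absurd hn (lt_irrefl _)
    | one => exact fun _ => φ.map_one.trans χ.map_one.symm
    | prime p hp => exact fun _ => h ⟨p, hp⟩
    | mul a b ha hb =>
      intro hn
      have ha0 : 0 < a := Nat.pos_of_mul_pos_right hn
      have hb0 : 0 < b := Nat.pos_of_mul_pos_left hn
      exact (map_mul φ (⟨a, ha0⟩ : ℕ+) (⟨b, hb0⟩ : ℕ+)).trans
        ((congrArg₂ (· * ·) (ha ha0) (hb hb0)).trans
          (map_mul χ (⟨a, ha0⟩ : ℕ+) (⟨b, hb0⟩ : ℕ+)).symm)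
  exact MonoidHom.ext fun n => key n n.pos

/-! ### Cocycles and their values at the primes -/

namespace LambdaRing

variable {R : Type*} [CommRing R] [LambdaRing R]

variable (R) in
/-- The Adams operations as a homomorphism of monoids. -/
def psiHom : ℕ+ →* Module.End ℤ R where
  toFun := psi
  map_one' := psi_one
  map_mul' := psi_mul

/-- A function satisfying the cocycle identity gives a homomorphism to the trivial square-zero
extension of `End(R)` by itself. -/
def derivationHom (f : ℕ+ → Module.End ℤ R)
    (hf : ∀ m n, f (m * n) = psi m * f n + f m * psi n) :
    ℕ+ →* TrivSqZeroExt (Module.End ℤ R) (Module.End ℤ R) where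
  toFun n := (psi n, f n)
  map_one' := by
    -- This reads `f(1) = f(1) + f(1)`, which forces `f(1) = 0`.
    have h := hf 1 1
    rw [mul_one, psi_one, one_mul, mul_one, left_eq_add] at h
    rw [psi_one, h]
    rfl
  map_mul' m n := TrivSqZeroExt.ext (psi_mul m n) (hf m n)

/-- The hypothesis is the second coordinate of the statement that `(ψ^p, f(p))` and `(ψ^q, f(q))`
commute in the square-zero extension; freeness then extends the family to all positive integers. -/
theorem exists_derivation_of_primes (f : Nat.Primes → Module.End ℤ R)
    (hf : ∀ p q : Nat.Primes, psi p * f q + f p * psi q = psi q * f p + f q * psi p) :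
    ∃ F : ℕ+ → Module.End ℤ R, (∀ m n, F (m * n) = psi m * F n + F m * psi n) ∧
      ∀ p : Nat.Primes, F (p : ℕ+) = f p := by
  obtain ⟨φ, hφ⟩ := PNat.exists_monoidHom_of_primes
    (M := TrivSqZeroExt (Module.End ℤ R) (Module.End ℤ R)) (fun p => (psi p, f p)) fun p q =>
      TrivSqZeroExt.ext
        (show (psi p * psi q : Module.End ℤ R) = psi q * psi p by
          rw [← psi_mul, ← psi_mul, mul_comm])
        (hf p q)
  -- The first coordinate of the extension agrees with `ψ` at the primes, hence everywhere, so the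
  -- second coordinate satisfies the cocycle identity.
  have h1 : (TrivSqZeroExt.fstHom ℤ (Module.End ℤ R) (Module.End ℤ R) :
      TrivSqZeroExt (Module.End ℤ R) (Module.End ℤ R) →* Module.End ℤ R).comp φ = psiHom R :=
    PNat.monoidHom_ext_primes fun p => by
      change (φ p).fst = psi p
      rw [hφ]
      rfl
  have h2 : ∀ n, (φ n).fst = psi n := fun n => DFunLike.congr_fun h1 n
  refine ⟨fun n => (φ n).snd, fun m n => ?_, fun p => congrArg TrivSqZeroExt.snd (hφ p)⟩
  rw [← h2, ← h2]
  exact congrArg TrivSqZeroExt.snd (map_mul φ m n)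

theorem derivation_eq_zero_of_primes {f : ℕ+ → Module.End ℤ R}
    (hf : ∀ m n, f (m * n) = psi m * f n + f m * psi n)
    (h : ∀ p : Nat.Primes, f (p : ℕ+) = 0) : f = 0 := by
  have h0 : derivationHom f hf = derivationHom 0 (by simp) :=
    PNat.monoidHom_ext_primes fun p => TrivSqZeroExt.ext rfl (h p)
  funext n
  exact congrArg TrivSqZeroExt.snd (DFunLike.congr_fun h0 n)

theorem mem_Z_one {f : Coch R 1} (hF : f ∈ F R 1)
    (hf : ∀ m n : ℕ+, f (fun _ => m * n) = psi m * f (fun _ => n) + f (fun _ => m) * psi n) :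
    f ∈ Z R 1 := by
  refine ⟨hF, ?_⟩
  change d 1 f = 0
  funext m
  have e1 : (fun i : Fin 1 => m i.succ) = fun _ => m 1 := by
    funext i; fin_cases i; rfl
  have e2 : (fun i : Fin 1 => m i.castSucc) = fun _ => m 0 := by
    funext i; fin_cases i; rfl
  have e3 : Fin.contractNth (Fin.castSucc (0 : Fin 1)) (· * ·) m = fun _ => m 0 * m 1 := by
    funext i; fin_cases i; rfl
  rw [d_apply, e1, e2, Fin.sum_univ_one, e3, hf]
  have e4 : m (Fin.last 1) = m 1 := rfl
  rw [e4, Pi.zero_apply]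
  simp only [Fin.val_zero, zero_add, pow_one, neg_smul, one_smul, one_add_one_eq_two, even_two,
    Even.neg_pow, one_pow]
  abel

/-- The extended family lies in `F R 1` because the divisibility required there concerns its values
at primes only. -/
theorem restrictPrimes_surjective :
    Function.Surjective (restrictPrimes : Z R 1 →+ DerBar R) := by
  intro f
  obtain ⟨G, hG, hGp⟩ := exists_derivation_of_primes f.1 f.2.2
  refine ⟨⟨fun m => G (m 0), mem_Z_one (fun p r => ?_) hG⟩, Subtype.ext (funext hGp)⟩
  rw [hGp]
  exact f.2.1 p r

theorem restrictPrimes_injective :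
    Function.Injective (restrictPrimes : Z R 1 →+ DerBar R) := by
  refine (injective_iff_map_eq_zero _).2 fun f hf => Subtype.ext (funext fun m => ?_)
  have h := derivation_eq_zero_of_primes (f := fun n => f.1 fun _ => n) (cocycle_one f.2)
    fun p => congrFun (congrArg Subtype.val hf) p
  have e : m = fun _ => m 0 := by
    funext i; fin_cases i; rfl
  rw [e]
  exact congrFun h (m 0)

theorem piMap_mk (f : Z R 1) : piMap R (H.mk f) = HBarOne.mk (restrictPrimes f) := rfl

theorem d_zero_apply (g : Coch R 0) (n : ℕ+) :
    d 0 g (fun _ => n) = psi n * g default - g default * psi n := by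
  rw [d_apply, Subsingleton.elim (fun i : Fin 0 => n) default]
  simp [sub_eq_add_neg]

/-- The commutator with `g` is a derivation along `ψ`: the two terms `ψ^m g ψ^n` cancel.
Divisibility at primes is assumed, since where this is used it is inherited from a given cocycle. -/
theorem d_zero_mem_Z_one {g : Coch R 0}
    (hg : ∀ (p : Nat.Primes) (r : R), ((p : ℕ) : R) ∣ d 0 g (fun _ => (p : ℕ+)) r) :
    d 0 g ∈ Z R 1 := by
  refine mem_Z_one hg fun m n => ?_
  rw [d_zero_apply, d_zero_apply, d_zero_apply, psi_mul]
  noncomm_ring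

/-- Restriction to primes is bijective on cocycles. If a restricted cocycle is inner, given by `g`,
then it and the coboundary of `g` are cocycles with the same values at primes, hence equal. -/
theorem piMap_bijective : Function.Bijective (piMap R) := by
  constructor
  · refine (injective_iff_map_eq_zero _).2 fun x hx => ?_
    obtain ⟨f, rfl⟩ := H.mk_surjective x
    rw [piMap_mk] at hx
    obtain ⟨g, hg, hgf⟩ := (QuotientAddGroup.eq_zero_iff (restrictPrimes f)).1 hx
    refine H.mk_eq_zero ⟨fun _ => g, hg, ?_⟩
    have h : ∀ p : Nat.Primes, d 0 (fun _ => g : Coch R 0) (fun _ => (p : ℕ+)) =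
        (restrictPrimes f).1 p := fun p => (d_zero_apply _ _).trans (congrFun hgf p)
    have hZ : d 0 (fun _ => g : Coch R 0) ∈ Z R 1 := d_zero_mem_Z_one fun p r => by
      rw [h]
      exact (restrictPrimes f).2.1 p r
    exact congrArg Subtype.val (@restrictPrimes_injective R _ _ ⟨_, hZ⟩ f
      (Subtype.ext (funext h)))
  · intro y
    obtain ⟨f, rfl⟩ := QuotientAddGroup.mk'_surjective _ y
    obtain ⟨f, rfl⟩ := restrictPrimes_surjective f
    exact ⟨H.mk f, rfl⟩

end LambdaRing

/-! ### Transport of the graded algebra structure -/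

namespace LambdaRing

variable (R : Type*) [CommRing R] [LambdaRing R]

theorem idPi_bijective : Function.Bijective (idPi R) :=
  (Function.bijective_id.prodMap piMap_bijective).comp (HLeOne.equivProd R).bijective

/-- The isomorphism of groups `(Id, π)`. -/
noncomputable def idPiEquiv : HLeOne R ≃+ HBarLeOne R := AddEquiv.ofBijective (idPi R) (idPi_bijective R)

variable {R}

/-- The class in `H^{≤1}(R)` of an element of `H^i(R)`. -/
def HLeOne.of (i : ℕ) : H R i →+ HLeOne R :=
  (Ideal.Quotient.mk (degreeGETwo R)).toAddMonoidHom.comp (DirectSum.of (H R) i)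

theorem HLeOne.of_mul_of {i j : ℕ} (a : H R i) (b : H R j) :
    HLeOne.of i a * HLeOne.of j b = HLeOne.of (i + j) (compH i j a b) := by
  change Ideal.Quotient.mk (degreeGETwo R) _ * Ideal.Quotient.mk (degreeGETwo R) _ =
    Ideal.Quotient.mk (degreeGETwo R) _
  rw [← map_mul, DirectSum.of_mul_of]
  rfl

theorem idPi_of (i : ℕ) (a : H R i) : idPi R (HLeOne.of i a) =
    (DirectSum.of (H R) i a 0, piMap R (DirectSum.of (H R) i a 1)) := rfl

theorem idPi_of_zero (a : H R 0) : idPi R (HLeOne.of 0 a) = (a, 0) := by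
  rw [idPi_of, DirectSum.of_eq_same, DirectSum.of_eq_of_ne _ _ _ (by omega), map_zero]

theorem idPi_of_one (a : H R 1) : idPi R (HLeOne.of 1 a) = (0, piMap R a) := by
  rw [idPi_of, DirectSum.of_eq_same, DirectSum.of_eq_of_ne _ _ _ (by omega)]

theorem idPi_of_add_two (i : ℕ) (a : H R (i + 2)) : idPi R (HLeOne.of (i + 2) a) = 0 := by
  rw [idPi_of, DirectSum.of_eq_of_ne _ _ _ (by omega), DirectSum.of_eq_of_ne _ _ _ (by omega),
    map_zero]
  rfl

theorem map_idPi_degree (i : ℕ) :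
    (HLeOne.degree R i).map (idPi R) = HBarLeOne.degree R i := by
  ext y
  rw [AddSubgroup.mem_map]
  match i with
  | 0 =>
    constructor
    · rintro ⟨_, ⟨a, rfl⟩, rfl⟩
      exact ⟨a, (idPi_of_zero a).symm⟩
    · rintro ⟨a, rfl⟩
      exact ⟨_, ⟨a, rfl⟩, idPi_of_zero a⟩
  | 1 =>
    constructor
    · rintro ⟨_, ⟨a, rfl⟩, rfl⟩
      exact ⟨piMap R a, (idPi_of_one a).symm⟩
    · rintro ⟨a, rfl⟩
      obtain ⟨a, rfl⟩ := piMap_bijective.2 a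
      exact ⟨_, ⟨a, rfl⟩, idPi_of_one a⟩
  | i + 2 =>
    constructor
    · rintro ⟨_, ⟨a, rfl⟩, rfl⟩
      exact idPi_of_add_two i a
    · intro hy
      exact ⟨0, zero_mem _, ((AddSubgroup.mem_bot.1 hy).trans (map_zero _).symm).symm⟩

variable (R) in
theorem HBarLeOne.isInternal_degree : DirectSum.IsInternal (HBarLeOne.degree R) := by
  -- The summation map reads its two coordinates from degrees `0` and `1`; the parts of higher
  -- degree vanish.
  have hc : ∀ x : DirectSum ℕ fun i => HBarLeOne.degree R i,
      DirectSum.coeAddMonoidHom (HBarLeOne.degree R) x = ((x 0).1.1, (x 1).1.2) := by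
    intro x
    induction x using DirectSum.induction_on with
    | zero => rfl
    | of i x =>
      rw [DirectSum.coeAddMonoidHom_of]
      match i, x with
      | 0, ⟨_, a, rfl⟩ =>
        rw [DirectSum.of_eq_same, DirectSum.of_eq_of_ne _ _ _ (by omega)]
        rfl
      | 1, ⟨_, a, rfl⟩ =>
        rw [DirectSum.of_eq_same, DirectSum.of_eq_of_ne _ _ _ (by omega)]
        rfl
      | i + 2, ⟨x, hx⟩ =>
        rw [DirectSum.of_eq_of_ne _ _ _ (by omega), DirectSum.of_eq_of_ne _ _ _ (by omega)]
        exact AddSubgroup.mem_bot.1 hx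
    | add x y hx hy =>
      rw [map_add, hx, hy]
      rfl
  constructor
  · refine (injective_iff_map_eq_zero _).2 fun x hx => ?_
    rw [hc, Prod.mk_eq_zero] at hx
    refine DFinsupp.ext fun i => Subtype.ext ?_
    match i with
    | 0 =>
      obtain ⟨a, ha⟩ := (x 0).2
      exact Prod.ext hx.1 (by rw [← ha]; rfl)
    | 1 =>
      obtain ⟨a, ha⟩ := (x 1).2
      exact Prod.ext (by rw [← ha]; rfl) hx.2
    | i + 2 => exact AddSubgroup.mem_bot.1 (x (i + 2)).2
  · rintro ⟨a, b⟩
    refine ⟨DirectSum.of (fun i => HBarLeOne.degree R i) 0 ⟨(a, 0), a, rfl⟩ +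
      DirectSum.of (fun i => HBarLeOne.degree R i) 1 ⟨(0, b), b, rfl⟩, ?_⟩
    rw [map_add, DirectSum.coeAddMonoidHom_of, DirectSum.coeAddMonoidHom_of]
    simp

/-- The multiplication on `\bar H^{≤1}(R)` transported along `(Id, π)`. -/
noncomputable def HBarLeOne.mulHom : HBarLeOne R →+ HBarLeOne R →+ HBarLeOne R :=
  ((AddMonoidHom.mul.compr₂ (idPi R)).compl₂ (idPiEquiv R).symm.toAddMonoidHom).comp
    (idPiEquiv R).symm.toAddMonoidHom

/-- As `idPi` is surjective, this determines the product, and every algebra law reduces to its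
counterpart in `HLeOne R`. -/
theorem HBarLeOne.mulHom_idPi (x y : HLeOne R) :
    HBarLeOne.mulHom (idPi R x) (idPi R y) = idPi R (x * y) := by
  change idPi R ((idPiEquiv R).symm (idPiEquiv R x) * (idPiEquiv R).symm (idPiEquiv R y)) = _
  rw [AddEquiv.symm_apply_apply, AddEquiv.symm_apply_apply]

variable (R) in
/-- The structure of graded algebra on `\bar H^{≤1}(R)` transported along `(Id, π)`. -/
noncomputable def HBarLeOne.gradedAlgebraStructure :
    GradedAlgebraStructure (HBarLeOne R) (HBarLeOne.degree R) where
  mul := HBarLeOne.mulHom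
  one := idPi R 1
  mul_assoc x y z := by
    obtain ⟨x, rfl⟩ := (idPi_bijective R).2 x
    obtain ⟨y, rfl⟩ := (idPi_bijective R).2 y
    obtain ⟨z, rfl⟩ := (idPi_bijective R).2 z
    simp only [HBarLeOne.mulHom_idPi, mul_assoc]
  one_mul x := by
    obtain ⟨x, rfl⟩ := (idPi_bijective R).2 x
    rw [HBarLeOne.mulHom_idPi, one_mul]
  mul_one x := by
    obtain ⟨x, rfl⟩ := (idPi_bijective R).2 x
    rw [HBarLeOne.mulHom_idPi, mul_one]
  isInternal := HBarLeOne.isInternal_degree R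
  one_mem := by
    rw [← map_idPi_degree]
    exact ⟨1, ⟨GradedMonoid.GOne.one, rfl⟩, rfl⟩
  mul_mem {i j x y} hx hy := by
    rw [← map_idPi_degree] at hx hy ⊢
    obtain ⟨_, ⟨a, rfl⟩, rfl⟩ := hx
    obtain ⟨_, ⟨b, rfl⟩, rfl⟩ := hy
    exact ⟨_, ⟨compH i j a b, (HLeOne.of_mul_of a b).symm⟩, (HBarLeOne.mulHom_idPi _ _).symm⟩

/-- The family is lifted to a cocycle, multiplied there by composition, and restricted back to the
primes. -/
theorem HBarLeOne.mulHom_mk_left (g : Z R 0) (f : DerBar R) :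
    HBarLeOne.mulHom (H.mk g, 0) (0, HBarOne.mk f) = (0, HBarOne.mk (lmulDerBar g f)) := by
  obtain ⟨f, rfl⟩ := restrictPrimes_surjective f
  rw [← piMap_mk, ← idPi_of_zero, ← idPi_of_one, HBarLeOne.mulHom_idPi, HLeOne.of_mul_of,
    compH_mk]
  refine (idPi_of_one (H.mk (compZ 0 1 g f : Z R 1))).trans ?_
  rw [piMap_mk]
  refine congrArg (fun x => ((0, HBarOne.mk x) : HBarLeOne R)) (Subtype.ext (funext fun p => ?_))
  -- A 0-cochain is a function on the one-point set `T^0`, so its argument is immaterial.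
  exact congrArg (fun x => g.1 x * f.1 fun _ => (p : ℕ+)) (Subsingleton.elim _ _)

theorem HBarLeOne.mulHom_mk_right (f : DerBar R) (g : Z R 0) :
    HBarLeOne.mulHom (0, HBarOne.mk f) (H.mk g, 0) = (0, HBarOne.mk (rmulDerBar f g)) := by
  obtain ⟨f, rfl⟩ := restrictPrimes_surjective f
  rw [← piMap_mk, ← idPi_of_zero, ← idPi_of_one, HBarLeOne.mulHom_idPi, HLeOne.of_mul_of,
    compH_mk]
  refine (idPi_of_one (H.mk (compZ 1 0 f g : Z R 1))).trans ?_
  rw [piMap_mk]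
  refine congrArg (fun x => ((0, HBarOne.mk x) : HBarLeOne R)) (Subtype.ext (funext fun p => ?_))
  exact congrArg (fun x => f.1 (fun _ => (p : ℕ+)) * g.1 x) (Subsingleton.elim _ _)

end LambdaRing

theorem corollary2p5 (R : Type*) [CommRing R] [LambdaRing R] :
    Function.Bijective (LambdaRing.idPi R) ∧
    ∃ S : GradedAlgebraStructure (LambdaRing.HBarLeOne R) (LambdaRing.HBarLeOne.degree R),
      (∀ x y : LambdaRing.HLeOne R,
        LambdaRing.idPi R (x * y) = S.mul (LambdaRing.idPi R x) (LambdaRing.idPi R y)) ∧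
      LambdaRing.idPi R 1 = S.one ∧
      (∀ i : ℕ, (LambdaRing.HLeOne.degree R i).map (LambdaRing.idPi R) =
        LambdaRing.HBarLeOne.degree R i) ∧
      (∀ S' : GradedAlgebraStructure (LambdaRing.HBarLeOne R) (LambdaRing.HBarLeOne.degree R),
        (∀ x y : LambdaRing.HLeOne R,
          LambdaRing.idPi R (x * y) = S'.mul (LambdaRing.idPi R x) (LambdaRing.idPi R y)) →
        S' = S) ∧
      ∀ (g : LambdaRing.Z R 0) (f : LambdaRing.DerBar R),
        S.mul (LambdaRing.H.mk g, 0) (0, LambdaRing.HBarOne.mk f) =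
          (0, LambdaRing.HBarOne.mk (LambdaRing.lmulDerBar g f)) ∧
        S.mul (0, LambdaRing.HBarOne.mk f) (LambdaRing.H.mk g, 0) =
          (0, LambdaRing.HBarOne.mk (LambdaRing.rmulDerBar f g)) := by
  refine ⟨LambdaRing.idPi_bijective R, LambdaRing.HBarLeOne.gradedAlgebraStructure R,
    fun x y => (LambdaRing.HBarLeOne.mulHom_idPi x y).symm, rfl, LambdaRing.map_idPi_degree,
    fun S' hS' => ?_, fun g f => ⟨LambdaRing.HBarLeOne.mulHom_mk_left g f,
      LambdaRing.HBarLeOne.mulHom_mk_right f g⟩⟩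
  have hmul : S'.mul = (LambdaRing.HBarLeOne.gradedAlgebraStructure R).mul := by
    ext1 x
    ext1 y
    obtain ⟨x, rfl⟩ := (LambdaRing.idPi_bijective R).2 x
    obtain ⟨y, rfl⟩ := (LambdaRing.idPi_bijective R).2 y
    exact (hS' x y).symm.trans (LambdaRing.HBarLeOne.mulHom_idPi x y).symm
  refine GradedAlgebraStructure.ext hmul ?_
  -- A two-sided unit is determined by the multiplication, so preservation of `1` by `S'` need not
  -- be assumed.
  rw [← S'.mul_one (LambdaRing.HBarLeOne.gradedAlgebraStructure R).one, hmul,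
    GradedAlgebraStructure.one_mul]
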